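/- Let $\Sigma$ be a (possibly infinite) alphabet. **Pomsets.** A pomset over $\Sigma$ is an isomorphism class of finite $\Sigma$-labelled posets; $1$ is the empty pomset, and a letter is identified with the corresponding one-node pomset. $U\parallel V$ is the disjoint union of $U$ and $V$, and $U\cdot V$ is the disjoint union with all nodes of $U$ placed below all nodes of $V$. $\mathsf{SP}$ is the smallest set of pomsets that contains $1$ and all letters and is closed under $\cdot$ and $\parallel$. A series-parallel context $C$ is a series-parallel pomset over $\Sigma\cup\{*\}$ with exactly one node labelled $*$; $C[U]$ is obtained from $C$ by substituting the pomset $U$ for that node, and $C[L]=\{C[U] : U\in L\}$. **Terms.** Terms are given by $e,f ::= 0 \mid 1 \mid a\in\Sigma \mid e+f \mid e\cdot f \mid e\parallel f \mid e^*$, and $[\![e]\!]\subseteq\mathsf{SP}$ is the usual pomset language of $e$ (with $+$ as union, $\cdot$ and $\parallel$ pointwise, and $^*$ as iteration of $\cdot$). **Hypotheses.** A hypothesis is a formal inequation $e\le f$ between terms. For a set $H$ of hypotheses, $\equiv^H$ is the smallest congruence on terms that satisfies: * the axioms of bi-Kleene algebra, that is, the Kleene algebra axioms for $(+,\cdot,{}^*,0,1)$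 together with the axioms stating that $\parallel$ is commutative and associative, has unit $1$ and zero $0$, and distributes over $+$; * $e+f\equiv^H f$ for every $e\le f$ in $H$. We write $e\leqq^H f$ for $e+f\equiv^H f$, and say that $H$ *implies* $H'$ if $e\leqq^H f$ for every $e\le f$ in $H'$. The closure $H(L)$ of a pomset language $L$ is the smallest pomset language $X\supseteq L$ such that, for all $e\le f$ in $H$ and all series-parallel contexts $C$, if $C[[\![f]\!]]\subseteq X$ then $C[[\![e]\!]]\subseteq X$. We say that $H$ *factorises* into $H_0$ and $H_1$ if $H$ implies both $H_0$ and $H_1$, and $H(L)=H_1(H_0(L))$ for all $L\subseteq\mathsf{SP}$. We say that $H$ *strongly reduces* to $H'$ if $H$ implies $H'$ and there is a map $r$ on terms such that, for all terms $e,f$: $e\equiv^H r(e)$; if $H([\![e]\!])=H([\![f]\!])$ then $H'([\![r(e)]\!])=H'([\![r(f)]\!])$; and $H([\![e]\!])=H'([\![r(e)]\!])$. Finally, let $$\mathsf{exch}=\{(e\parallel f)\cdot(g\parallel h)\le(e\cdot g)\parallel(f\cdot h) : e,f,g,h \text{ terms}\}.$$ **Lemma.** Let $H$ be a set of hypotheses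 such that, for each $e\le f$ in $H$, either $e=1$ or $e=a$ for some letter $a\in\Sigma$. Then $H\cup\mathsf{exch}$ factorises into $\mathsf{exch}$ and $H$. Consequently, for every set $H'$ of hypotheses, if both $\mathsf{exch}$ and $H$ strongly reduce to $H'$, then $H\cup\mathsf{exch}$ strongly reduces to $H'$. -/

import Mathlib

universe u

namespace CKAH

/-- A finite labelled poset over the alphabet `A`. -/
structure LPoset (A : Type u) where
  carrier : Type
  ord : PartialOrder carrier
  fin : Finite carrier
  label : carrier → A

attribute [instance] LPoset.ord LPoset.fin

/-- Isomorphism of labelled posets: a label-preserving bijection that preserves and reflects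
the order. -/
def LPoset.Iso {A : Type u} (p q : LPoset A) : Prop :=
  ∃ h : p.carrier ≃o q.carrier, ∀ s, q.label (h s) = p.label s

theorem LPoset.Iso.refl {A : Type u} (p : LPoset A) : p.Iso p :=
  ⟨OrderIso.refl _, fun _ => rfl⟩

theorem LPoset.Iso.symm {A : Type u} {p q : LPoset A} (h : p.Iso q) : q.Iso p := by
  obtain ⟨h, hl⟩ := h
  exact ⟨h.symm, fun s => by rw [← hl, OrderIso.apply_symm_apply]⟩

theorem LPoset.Iso.trans {A : Type u} {p q r : LPoset A} (h : p.Iso q) (k : q.Iso r) :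
    p.Iso r := by
  obtain ⟨h, hl⟩ := h
  obtain ⟨k, kl⟩ := k
  exact ⟨h.trans k, fun s => by rw [OrderIso.trans_apply, kl, hl]⟩

instance LPoset.setoid (A : Type u) : Setoid (LPoset A) :=
  ⟨LPoset.Iso, LPoset.Iso.refl, LPoset.Iso.symm, LPoset.Iso.trans⟩

/-- Pomsets over `A`: isomorphism classes of finite labelled posets. -/
def Pom (A : Type u) : Type (max 1 u) := Quotient (LPoset.setoid A)

/-- The isomorphism class of a labelled poset. -/
def Pom.mk {A : Type u} (p : LPoset A) : Pom A := Quotient.mk _ p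

/-- The empty labelled poset. -/
def LPoset.one (A : Type u) : LPoset A where
  carrier := Empty
  ord := inferInstance
  fin := inferInstance
  label := Empty.elim

/-- The labelled poset with a single node, labelled `a`. -/
def LPoset.letter {A : Type u} (a : A) : LPoset A where
  carrier := Unit
  ord := inferInstance
  fin := inferInstance
  label := fun _ => a

/-- Parallel composition: disjoint union, with no order between the two operands. -/
def LPoset.par {A : Type u} (p q : LPoset A) : LPoset A where
  carrier := p.carrier ⊕ q.carrier
  ord := inferInstance
  fin := inferInstance
  label := Sum.elim p.label q.label

/-- Sequential composition: disjoint union, with every node of the left operand below every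
node of the right one. -/
def LPoset.seq {A : Type u} (p q : LPoset A) : LPoset A where
  carrier := p.carrier ⊕ₗ q.carrier
  ord := inferInstance
  fin := inferInstanceAs (Finite (p.carrier ⊕ q.carrier))
  label := fun s => Sum.elim p.label q.label (ofLex s)

theorem LPoset.par_iso {A : Type u} {p p' q q' : LPoset A} (h : p.Iso p') (k : q.Iso q') :
    (p.par q).Iso (p'.par q') := by
  obtain ⟨h, hl⟩ := h
  obtain ⟨k, kl⟩ := k
  refine ⟨OrderIso.sumCongr h k, ?_⟩
  rintro (s | s)
  · exact hl s
  · exact kl s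

theorem LPoset.seq_iso {A : Type u} {p p' q q' : LPoset A} (h : p.Iso p') (k : q.Iso q') :
    (p.seq q).Iso (p'.seq q') := by
  obtain ⟨h, hl⟩ := h
  obtain ⟨k, kl⟩ := k
  refine ⟨OrderIso.sumLexCongr h k, ?_⟩
  rintro (s | s)
  · exact hl s
  · exact kl s

/-- The empty pomset `1`. -/
def Pom.one {A : Type u} : Pom A := Pom.mk (LPoset.one A)

/-- The pomset with a single node, labelled `a`. -/
def Pom.letter {A : Type u} (a : A) : Pom A := Pom.mk (LPoset.letter a)

/-- Parallel composition of pomsets. -/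
def Pom.par {A : Type u} : Pom A → Pom A → Pom A :=
  Quotient.map₂ LPoset.par fun _ _ h _ _ k => LPoset.par_iso h k

/-- Sequential composition of pomsets. -/
def Pom.seq {A : Type u} : Pom A → Pom A → Pom A :=
  Quotient.map₂ LPoset.seq fun _ _ h _ _ k => LPoset.seq_iso h k

/-- Series-parallel pomsets. -/
inductive Pom.IsSP {A : Type u} : Pom A → Prop
  | one : IsSP Pom.one
  | letter (a : A) : IsSP (Pom.letter a)
  | par {U V : Pom A} : IsSP U → IsSP V → IsSP (U.par V)
  | seq {U V : Pom A} : IsSP U → IsSP V → IsSP (U.seq V)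

/-- The set of series-parallel pomsets over `A`. -/
def SP (A : Type u) : Set (Pom A) := {U | U.IsSP}

/-! Pomset contexts. The alphabet extended with the gap symbol is `Option A`, and the gap
symbol is `none`. -/

/-- `s` is the only node of `c` that carries the gap symbol. -/
def LPoset.IsGap {A : Type u} (c : LPoset (Option A)) (s : c.carrier) : Prop :=
  c.label s = none ∧ ∀ t, c.label t = none → t = s

/-- The pomset `C` has exactly one node that carries the gap symbol. -/
def Pom.HasGap {A : Type u} (C : Pom (Option A)) : Prop :=
  ∃ c : LPoset (Option A), Pom.mk c = C ∧ ∃ s, c.IsGap s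

/-- Pomset contexts over `A`. -/
def PC (A : Type u) : Type (max 1 u) := {C : Pom (Option A) // C.HasGap}

/-- Series-parallel pomset contexts over `A`. -/
def PCsp (A : Type u) : Set (PC A) := {C | C.1 ∈ SP (Option A)}

/-- The nodes of a context with gap `s : P` into which a poset `Q` is plugged: the nodes of the
context other than `s`, and the nodes of `Q`. -/
inductive PlugNode {P : Type} (s : P) (Q : Type) : Type
  | outer (t : P) (ht : t ≠ s) : PlugNode s Q
  | inner (x : Q) : PlugNode s Q

theorem PlugNode.outer_congr {P : Type} {s : P} {Q : Type} {a b : P} (h : a = b) (ha : a ≠ s)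
    (hb : b ≠ s) : (PlugNode.outer a ha : PlugNode s Q) = PlugNode.outer b hb := by
  subst h
  rfl

/-- The order on `PlugNode s Q`: nodes of `Q` relate to nodes of the context as `s` does. -/
def PlugNode.le {P Q : Type} [PartialOrder P] [PartialOrder Q] {s : P} :
    PlugNode s Q → PlugNode s Q → Prop
  | outer t _, outer t' _ => t ≤ t'
  | inner x, inner x' => x ≤ x'
  | outer t _, inner _ => t ≤ s
  | inner _, outer t' _ => s ≤ t'

instance PlugNode.partialOrder {P Q : Type} [PartialOrder P] [PartialOrder Q] (s : P) :
    PartialOrder (PlugNode s Q) where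
  le := PlugNode.le
  le_refl := by
    rintro (⟨t, ht⟩ | x)
    · exact le_refl t
    · exact le_refl x
  le_trans := by
    rintro (⟨a, ha⟩ | a) (⟨b, hb⟩ | b) (⟨c, hc⟩ | c) h k <;> simp only [PlugNode.le] at * <;>
      first | exact h.trans k | exact h | exact k | skip
    exact absurd (le_antisymm k h) hb
  le_antisymm := by
    rintro (⟨a, ha⟩ | a) (⟨b, hb⟩ | b) h k <;> simp only [PlugNode.le] at *
    · cases le_antisymm h k
      rfl
    · exact absurd (le_antisymm h k) ha
    · exact absurd (le_antisymm k h) hb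
    · exact congrArg _ (le_antisymm h k)

instance PlugNode.finite {P Q : Type} [Finite P] [Finite Q] (s : P) :
    Finite (PlugNode s Q) := by
  refine Finite.of_injective (β := P ⊕ Q)
    (fun n => match n with
      | outer t _ => Sum.inl t
      | inner x => Sum.inr x) ?_
  rintro (⟨a, ha⟩ | a) (⟨b, hb⟩ | b) h <;> simp_all

/-- The labels of a context with gap `s` into which `p` is plugged. -/
def LPoset.plugLabel {A : Type u} (c : LPoset (Option A)) (s : c.carrier) (hs : c.IsGap s)
    (p : LPoset A) : PlugNode s p.carrier → A
  | .outer t ht => (c.label t).get (Option.isSome_iff_ne_none.2 fun h => ht (hs.2 t h))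
  | .inner x => p.label x

/-- The labelled poset obtained from `c` by replacing its gap `s` by `p`. -/
def LPoset.plug {A : Type u} (c : LPoset (Option A)) (s : c.carrier) (hs : c.IsGap s)
    (p : LPoset A) : LPoset A where
  carrier := PlugNode s p.carrier
  ord := inferInstance
  fin := inferInstance
  label := c.plugLabel s hs p

theorem LPoset.plug_iso {A : Type u} {c d : LPoset (Option A)} {s : c.carrier} {t : d.carrier}
    (hs : c.IsGap s) (ht : d.IsGap t) {p q : LPoset A} (h : c.Iso d) (k : p.Iso q) :
    (c.plug s hs p).Iso (d.plug t ht q) := by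
  obtain ⟨h, hl⟩ := h
  obtain ⟨k, kl⟩ := k
  have hst : h s = t := ht.2 _ (by rw [hl, hs.1])
  have hst' : h.symm t = s := by rw [← hst, OrderIso.symm_apply_apply]
  refine ⟨⟨⟨fun n => match n with
      | .outer a ha => .outer (h a) (fun e => ha (h.injective (e.trans hst.symm)))
      | .inner x => .inner (k x),
    fun n => match n with
      | .outer a ha => .outer (h.symm a) (fun e => ha (h.symm.injective (e.trans hst'.symm)))
      | .inner x => .inner (k.symm x), ?_, ?_⟩, ?_⟩, ?_⟩
  · rintro (⟨a, ha⟩ | a)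
    · exact PlugNode.outer_congr (h.symm_apply_apply a) _ _
    · exact congrArg PlugNode.inner (k.symm_apply_apply a)
  · rintro (⟨a, ha⟩ | a)
    · exact PlugNode.outer_congr (h.apply_symm_apply a) _ _
    · exact congrArg PlugNode.inner (k.apply_symm_apply a)
  · rintro (⟨a, ha⟩ | a) (⟨b, hb⟩ | b)
    · exact h.le_iff_le
    · change h a ≤ t ↔ a ≤ s
      rw [← hst]
      exact h.le_iff_le
    · change t ≤ h b ↔ s ≤ b
      rw [← hst]
      exact h.le_iff_le
    · exact k.le_iff_le
  · rintro (⟨a, ha⟩ | a)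
    · change (d.label (h a)).get _ = (c.label a).get _
      simp only [hl]
    · exact kl a

/-- `C[U]`: the pomset `U` plugged into the gap of the context `C`. It does not depend on the
representatives chosen, see `PC.plug_mk`. -/
noncomputable def PC.plug {A : Type u} (C : PC A) (U : Pom A) : Pom A :=
  Pom.mk
    (LPoset.plug C.2.choose C.2.choose_spec.2.choose C.2.choose_spec.2.choose_spec
      (Quotient.out U))

theorem PC.plug_mk {A : Type u} (c : LPoset (Option A)) (s : c.carrier) (hs : c.IsGap s)
    (p : LPoset A) :
    PC.plug ⟨Pom.mk c, c, rfl, s, hs⟩ (Pom.mk p) =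
      Pom.mk (c.plug s hs p) := by
  have hC : (Pom.mk c).HasGap := ⟨c, rfl, s, hs⟩
  exact Quotient.sound (LPoset.plug_iso _ _ (Quotient.exact hC.choose_spec.1)
    (Quotient.exact (Quotient.out_eq (Pom.mk p))))

/-! Terms and their semantics. -/

/-- Terms of concurrent Kleene algebra over `A`. -/
inductive Trm (A : Type u) : Type u
  | zero : Trm A
  | one : Trm A
  | letter (a : A) : Trm A
  | plus (e f : Trm A) : Trm A
  | seq (e f : Trm A) : Trm A
  | par (e f : Trm A) : Trm A
  | star (e : Trm A) : Trm A

/-- `L ^ n` with respect to sequential composition. -/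
def langPow {A : Type u} (L : Set (Pom A)) : ℕ → Set (Pom A)
  | 0 => {Pom.one}
  | n + 1 => Set.image2 Pom.seq (langPow L n) L

/-- The pomset language denoted by a term. -/
def sem {A : Type u} : Trm A → Set (Pom A)
  | .zero => ∅
  | .one => {Pom.one}
  | .letter a => {Pom.letter a}
  | .plus e f => sem e ∪ sem f
  | .seq e f => Set.image2 Pom.seq (sem e) (sem f)
  | .par e f => Set.image2 Pom.par (sem e) (sem f)
  | .star e => ⋃ n : ℕ, langPow (sem e) n

/-! Hypotheses. -/

/-- A hypothesis `lhs ≤ rhs` between terms. -/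
@[ext]
structure Hyp (A : Type u) : Type u where
  lhs : Trm A
  rhs : Trm A

/-- Provable equivalence of terms under the hypotheses `H`: the smallest congruence generated by
the axioms of bi-Kleene algebra and the hypotheses in `H`, where `e ≤ f` stands for
`e + f ≡ f`. -/
inductive Eqv {A : Type u} (H : Set (Hyp A)) : Trm A → Trm A → Prop
  | hyp {h : Hyp A} : h ∈ H → Eqv H (.plus h.lhs h.rhs) h.rhs
  | refl (e) : Eqv H e e
  | symm {e f} : Eqv H e f → Eqv H f e
  | trans {e f g} : Eqv H e f → Eqv H f g → Eqv H e g
  | plus_congr {e e' f f'} : Eqv H e e' → Eqv H f f' → Eqv H (.plus e f) (.plus e' f')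
  | seq_congr {e e' f f'} : Eqv H e e' → Eqv H f f' → Eqv H (.seq e f) (.seq e' f')
  | par_congr {e e' f f'} : Eqv H e e' → Eqv H f f' → Eqv H (.par e f) (.par e' f')
  | star_congr {e e'} : Eqv H e e' → Eqv H (.star e) (.star e')
  | plus_zero (e) : Eqv H (.plus e .zero) e
  | plus_idem (e) : Eqv H (.plus e e) e
  | plus_comm (e f) : Eqv H (.plus e f) (.plus f e)
  | plus_assoc (e f g) : Eqv H (.plus e (.plus f g)) (.plus (.plus e f) g)
  | seq_assoc (e f g) : Eqv H (.seq e (.seq f g)) (.seq (.seq e f) g)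
  | seq_plus (e f g) : Eqv H (.seq e (.plus f g)) (.plus (.seq e f) (.seq e g))
  | plus_seq (e f g) : Eqv H (.seq (.plus e f) g) (.plus (.seq e g) (.seq f g))
  | seq_one (e) : Eqv H (.seq e .one) e
  | one_seq (e) : Eqv H (.seq .one e) e
  | seq_zero (e) : Eqv H (.seq e .zero) .zero
  | zero_seq (e) : Eqv H (.seq .zero e) .zero
  | par_comm (e f) : Eqv H (.par e f) (.par f e)
  | par_one (e) : Eqv H (.par e .one) e
  | par_zero (e) : Eqv H (.par e .zero) .zero
  | par_assoc (e f g) : Eqv H (.par e (.par f g)) (.par (.par e f) g)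
  | par_plus (e f g) : Eqv H (.par e (.plus f g)) (.plus (.par e f) (.par e g))
  | star_left (e) : Eqv H (.plus .one (.seq e (.star e))) (.star e)
  | star_right (e) : Eqv H (.plus .one (.seq (.star e) e)) (.star e)
  | lfp_left {e f g} : Eqv H (.plus (.plus e (.seq f g)) g) g →
      Eqv H (.plus (.seq (.star f) e) g) g
  | lfp_right {e f g} : Eqv H (.plus (.plus e (.seq f g)) f) f →
      Eqv H (.plus (.seq e (.star g)) f) f

/-- `e ≤ f` is provable under the hypotheses `H`. -/
def Leqv {A : Type u} (H : Set (Hyp A)) (e f : Trm A) : Prop := Eqv H (.plus e f) f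

/-- `H` implies `H'`: every hypothesis in `H'` is provable from `H`. -/
def Implies {A : Type u} (H H' : Set (Hyp A)) : Prop := ∀ h ∈ H', Leqv H h.lhs h.rhs

/-- Membership in the `H`-closure of the pomset language `L`. -/
inductive InClosure {A : Type u} (H : Set (Hyp A)) (L : Set (Pom A)) : Pom A → Prop
  | base {U : Pom A} : U ∈ L → InClosure H L U
  | step {h : Hyp A} {C : PC A} {V : Pom A} : h ∈ H → C ∈ PCsp A →
      (∀ U ∈ sem h.rhs, InClosure H L (C.plug U)) → V ∈ sem h.lhs → InClosure H L (C.plug V)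

/-- The `H`-closure of `L`: the smallest language `X` that contains `L` and such that, for all
`e ≤ f` in `H` and all series-parallel contexts `C`, if `C[⟦f⟧] ⊆ X` then `C[⟦e⟧] ⊆ X`. -/
def closure {A : Type u} (H : Set (Hyp A)) (L : Set (Pom A)) : Set (Pom A) :=
  {U | InClosure H L U}

/-- The exchange law, as a set of hypotheses. -/
def exch (A : Type u) : Set (Hyp A) :=
  {h | ∃ e f g k : Trm A,
    h = ⟨.seq (.par e f) (.par g k), .par (.seq e g) (.seq f k)⟩}

/-- `H` factorises into `H₀` and `H₁`. -/
def Factorises {A : Type u} (H H₀ H₁ : Set (Hyp A)) : Prop :=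
  Implies H H₀ ∧ Implies H H₁ ∧
    ∀ L : Set (Pom A), L ⊆ SP A → closure H L = closure H₁ (closure H₀ L)

/-- `r` is a reduction from `H` to `H'`. -/
structure IsReduction {A : Type u} (H H' : Set (Hyp A)) (r : Trm A → Trm A) : Prop where
  implies : Implies H H'
  eqv : ∀ e, Eqv H e (r e)
  closure_eq : ∀ e f, closure H (sem e) = closure H (sem f) →
    closure H' (sem (r e)) = closure H' (sem (r f))

/-- `r` is a strong reduction from `H` to `H'`. -/
structure IsStrongReduction {A : Type u} (H H' : Set (Hyp A)) (r : Trm A → Trm A) : Prop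
    extends IsReduction H H' r where
  closure_sem : ∀ e, closure H (sem e) = closure H' (sem (r e))

/-- `H` strongly reduces to `H'`. -/
def StronglyReduces {A : Type u} (H H' : Set (Hyp A)) : Prop :=
  ∃ r : Trm A → Trm A, IsStrongReduction H H' r

end CKAH

/-! Both closures taken in succession stay inside the joint closure, so the factorisation comes down
to one fact: after closing under `exch` and then under `H`, the language is still closed under
`exch`. The idea is to replace exchange by an order. Among series-parallel pomsets, the exchange law
generates exactly subsumption (same nodes, possibly more order): `HypClosed.langLe_of_sub` and
`SubClosed.hypClosed_exch` say that a language of such pomsets is closed under `exch` if and only if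
it is downward closed for subsumption.

Downward closure survives closing under `H` (`SubClosed.closure`). Suppose `V` is subsumed by `C[1]`
or `C[a]`. The plugged piece has at most one node, so extra order cannot tear it apart, and `V` is
`C'[1]` or `C'[a]` for a series-parallel context `C'` subsumed by `C`. Then `C'[U]` is subsumed by
`C[U]` for every `U`, and the same hypothesis can be applied in `C'`. For a letter, `C'` is `V` with
one node turned into the gap. For `1`, a gap has to be inserted into `V` at a suitable place without
leaving the series-parallel posets (`Pom.IsSP.exists_insert`).

For strong reductions, the two maps are composed. Soundness of provable equivalence (`Eqv.sound`)
lets closure under implied hypotheses be absorbed into an outer closure. -/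

namespace CKAH

/-! ### Nodes of compositions of labelled posets -/

namespace LPoset

variable {A : Type u}

/-- A node of the left operand of a parallel composition. -/
def parInl {p q : LPoset A} (x : p.carrier) : (p.par q).carrier := Sum.inl x

/-- A node of the right operand of a parallel composition. -/
def parInr {p q : LPoset A} (x : q.carrier) : (p.par q).carrier := Sum.inr x

/-- A node of the left operand of a sequential composition. -/
def seqInl {p q : LPoset A} (x : p.carrier) : (p.seq q).carrier := toLex (Sum.inl x)

/-- A node of the right operand of a sequential composition. -/
def seqInr {p q : LPoset A} (x : q.carrier) : (p.seq q).carrier := toLex (Sum.inr x)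

/-- Case distinction on the nodes of a parallel composition. -/
def parElim {p q : LPoset A} {X : Type*} (f : p.carrier → X) (g : q.carrier → X) :
    (p.par q).carrier → X := Sum.elim f g

/-- Case distinction on the nodes of a sequential composition. -/
def seqElim {p q : LPoset A} {X : Type*} (f : p.carrier → X) (g : q.carrier → X) :
    (p.seq q).carrier → X := fun s => Sum.elim f g (ofLex s)

section
variable {p q : LPoset A}

theorem par_forall {P : (p.par q).carrier → Prop} :
    (∀ z, P z) ↔ (∀ x, P (parInl x)) ∧ ∀ y, P (parInr y) := Sum.forall

theorem seq_forall {P : (p.seq q).carrier → Prop} :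
    (∀ z, P z) ↔ (∀ x, P (seqInl x)) ∧ ∀ y, P (seqInr y) := Sum.forall

theorem par_exists {P : (p.par q).carrier → Prop} :
    (∃ z, P z) ↔ (∃ x, P (parInl x)) ∨ ∃ y, P (parInr y) := Sum.exists

theorem seq_exists {P : (p.seq q).carrier → Prop} :
    (∃ z, P z) ↔ (∃ x, P (seqInl x)) ∨ ∃ y, P (seqInr y) := Sum.exists

@[simp] theorem parInl_le_parInl {x y : p.carrier} :
    (parInl x : (p.par q).carrier) ≤ parInl y ↔ x ≤ y := Sum.inl_le_inl_iff

@[simp] theorem parInr_le_parInr {x y : q.carrier} :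
    (parInr x : (p.par q).carrier) ≤ parInr y ↔ x ≤ y := Sum.inr_le_inr_iff

@[simp] theorem parInl_le_parInr {x : p.carrier} {y : q.carrier} :
    (parInl x : (p.par q).carrier) ≤ parInr y ↔ False := iff_of_false Sum.not_inl_le_inr id

@[simp] theorem parInr_le_parInl {x : p.carrier} {y : q.carrier} :
    (parInr y : (p.par q).carrier) ≤ parInl x ↔ False := iff_of_false Sum.not_inr_le_inl id

@[simp] theorem seqInl_le_seqInl {x y : p.carrier} :
    (seqInl x : (p.seq q).carrier) ≤ seqInl y ↔ x ≤ y := Sum.Lex.inl_le_inl_iff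

@[simp] theorem seqInr_le_seqInr {x y : q.carrier} :
    (seqInr x : (p.seq q).carrier) ≤ seqInr y ↔ x ≤ y := Sum.Lex.inr_le_inr_iff

@[simp] theorem seqInl_le_seqInr {x : p.carrier} {y : q.carrier} :
    (seqInl x : (p.seq q).carrier) ≤ seqInr y ↔ True := iff_of_true (Sum.Lex.inl_le_inr _ _) ⟨⟩

@[simp] theorem seqInr_le_seqInl {x : p.carrier} {y : q.carrier} :
    (seqInr y : (p.seq q).carrier) ≤ seqInl x ↔ False := iff_of_false Sum.Lex.not_inr_le_inl id

@[simp] theorem label_parInl (x : p.carrier) : (p.par q).label (parInl x) = p.label x := rfl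
@[simp] theorem label_parInr (x : q.carrier) : (p.par q).label (parInr x) = q.label x := rfl
@[simp] theorem label_seqInl (x : p.carrier) : (p.seq q).label (seqInl x) = p.label x := rfl
@[simp] theorem label_seqInr (x : q.carrier) : (p.seq q).label (seqInr x) = q.label x := rfl

@[simp] theorem parInl_inj {x y : p.carrier} :
    (parInl x : (p.par q).carrier) = parInl y ↔ x = y := Sum.inl_injective.eq_iff
@[simp] theorem parInr_inj {x y : q.carrier} :
    (parInr x : (p.par q).carrier) = parInr y ↔ x = y := Sum.inr_injective.eq_iff
@[simp] theorem seqInl_inj {x y : p.carrier} :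
    (seqInl x : (p.seq q).carrier) = seqInl y ↔ x = y := Sum.inl_injective.eq_iff
@[simp] theorem seqInr_inj {x y : q.carrier} :
    (seqInr x : (p.seq q).carrier) = seqInr y ↔ x = y := Sum.inr_injective.eq_iff
@[simp] theorem parInl_ne_parInr {x : p.carrier} {y : q.carrier} :
    (parInl x : (p.par q).carrier) ≠ parInr y := Sum.inl_ne_inr
@[simp] theorem parInr_ne_parInl {x : p.carrier} {y : q.carrier} :
    (parInr y : (p.par q).carrier) ≠ parInl x := Sum.inr_ne_inl
@[simp] theorem seqInl_ne_seqInr {x : p.carrier} {y : q.carrier} :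
    (seqInl x : (p.seq q).carrier) ≠ seqInr y := fun h => Sum.inl_ne_inr (toLex.injective h)
@[simp] theorem seqInr_ne_seqInl {x : p.carrier} {y : q.carrier} :
    (seqInr y : (p.seq q).carrier) ≠ seqInl x := fun h => Sum.inr_ne_inl (toLex.injective h)

variable {X : Type*} {f : p.carrier → X} {g : q.carrier → X}

@[simp] theorem parElim_inl (x : p.carrier) : parElim f g (parInl x) = f x := rfl
@[simp] theorem parElim_inr (x : q.carrier) : parElim f g (parInr x) = g x := rfl
@[simp] theorem seqElim_inl (x : p.carrier) : seqElim f g (seqInl x) = f x := rfl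
@[simp] theorem seqElim_inr (x : q.carrier) : seqElim f g (seqInr x) = g x := rfl

end

/-- A map that reflects the order is injective by antisymmetry, so injectivity never has to be
checked for the concrete isomorphisms below. -/
theorem Iso.of_surjective {p q : LPoset A} (f : p.carrier → q.carrier)
    (hf : ∀ y, ∃ x, f x = y) (hle : ∀ x y, f x ≤ f y ↔ x ≤ y)
    (hl : ∀ x, q.label (f x) = p.label x) : p.Iso q :=
  ⟨{ Equiv.ofBijective f ⟨fun x y h => le_antisymm ((hle x y).1 h.le) ((hle y x).1 h.ge), hf⟩ with
      map_rel_iff' := hle _ _ }, hl⟩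

instance : IsEmpty (one A).carrier := inferInstanceAs (IsEmpty Empty)
instance (a : A) : Unique (letter a).carrier := inferInstanceAs (Unique Unit)

@[simp] theorem label_letter (a : A) (x) : (letter a).label x = a := rfl

end LPoset

open LPoset

variable {A B : Type u}

/-! ### Algebraic laws of pomsets -/

theorem Pom.mk_eq {p q : LPoset A} (h : p.Iso q) : Pom.mk p = Pom.mk q := Quotient.sound h

theorem Pom.iso_of_mk_eq {p q : LPoset A} (h : Pom.mk p = Pom.mk q) : p.Iso q := Quotient.exact h

theorem Pom.exists_mk (U : Pom A) : ∃ p, Pom.mk p = U := Quotient.exists_rep U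

theorem Pom.mk_par (p q : LPoset A) : Pom.mk (p.par q) = (Pom.mk p).par (Pom.mk q) := rfl

theorem Pom.mk_seq (p q : LPoset A) : Pom.mk (p.seq q) = (Pom.mk p).seq (Pom.mk q) := rfl

theorem Pom.seq_assoc (U V W : Pom A) : U.seq (V.seq W) = (U.seq V).seq W := by
  obtain ⟨u, rfl⟩ := U.exists_mk
  obtain ⟨v, rfl⟩ := V.exists_mk
  obtain ⟨w, rfl⟩ := W.exists_mk
  refine Pom.mk_eq (Iso.of_surjective
    (seqElim (fun x => seqInl (seqInl x)) (seqElim (fun x => seqInl (seqInr x)) seqInr)) ?_ ?_ ?_)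
  all_goals simp [seq_forall, seq_exists]

theorem Pom.par_assoc (U V W : Pom A) : U.par (V.par W) = (U.par V).par W := by
  obtain ⟨u, rfl⟩ := U.exists_mk
  obtain ⟨v, rfl⟩ := V.exists_mk
  obtain ⟨w, rfl⟩ := W.exists_mk
  refine Pom.mk_eq (Iso.of_surjective
    (parElim (fun x => parInl (parInl x)) (parElim (fun x => parInl (parInr x)) parInr)) ?_ ?_ ?_)
  all_goals simp [par_forall, par_exists]

theorem Pom.par_comm (U V : Pom A) : U.par V = V.par U := by
  obtain ⟨u, rfl⟩ := U.exists_mk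
  obtain ⟨v, rfl⟩ := V.exists_mk
  refine Pom.mk_eq (Iso.of_surjective (parElim parInr parInl) ?_ ?_ ?_)
  all_goals simp [par_forall, par_exists]

theorem Pom.par_one (U : Pom A) : U.par Pom.one = U := by
  obtain ⟨u, rfl⟩ := U.exists_mk
  refine Pom.mk_eq (Iso.symm (Iso.of_surjective parInl ?_ ?_ ?_))
  all_goals simp [par_forall]

theorem Pom.seq_one (U : Pom A) : U.seq Pom.one = U := by
  obtain ⟨u, rfl⟩ := U.exists_mk
  refine Pom.mk_eq (Iso.symm (Iso.of_surjective seqInl ?_ ?_ ?_))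
  all_goals simp [seq_forall]

theorem Pom.one_seq (U : Pom A) : Pom.one.seq U = U := by
  obtain ⟨u, rfl⟩ := U.exists_mk
  refine Pom.mk_eq (Iso.symm (Iso.of_surjective seqInr ?_ ?_ ?_))
  all_goals simp [seq_forall]

/-! ### Series-parallel posets: induction, relabelling and restriction -/

/-- Nodes exist only on representatives, while `IsSP` lives on the quotient. Induction on posets is
recovered at the price of an isomorphism-invariant motive. -/
theorem Pom.IsSP.lposet_induction {motive : LPoset A → Prop}
    (iso : ∀ p q : LPoset A, p.Iso q → motive p → motive q)
    (one : motive (LPoset.one A)) (letter : ∀ a, motive (LPoset.letter a))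
    (par : ∀ p q : LPoset A, (Pom.mk p).IsSP → (Pom.mk q).IsSP → motive p → motive q →
      motive (p.par q))
    (seq : ∀ p q : LPoset A, (Pom.mk p).IsSP → (Pom.mk q).IsSP → motive p → motive q →
      motive (p.seq q))
    {p : LPoset A} (hp : (Pom.mk p).IsSP) : motive p := by
  suffices H : ∀ U : Pom A, U.IsSP → ∀ p, Pom.mk p = U → motive p from H _ hp p rfl
  intro U hU
  induction hU with
  | one => exact fun p h => iso _ _ (Pom.iso_of_mk_eq h.symm) one
  | letter a => exact fun p h => iso _ _ (Pom.iso_of_mk_eq h.symm) (letter a)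
  | @par U V hU hV ihU ihV =>
    obtain ⟨u, rfl⟩ := U.exists_mk
    obtain ⟨v, rfl⟩ := V.exists_mk
    exact fun p h => iso _ _ (Pom.iso_of_mk_eq h.symm) (par u v hU hV (ihU u rfl) (ihV v rfl))
  | @seq U V hU hV ihU ihV =>
    obtain ⟨u, rfl⟩ := U.exists_mk
    obtain ⟨v, rfl⟩ := V.exists_mk
    exact fun p h => iso _ _ (Pom.iso_of_mk_eq h.symm) (seq u v hU hV (ihU u rfl) (ihV v rfl))

/-- The poset `p` with new labels. -/
def LPoset.relabel (p : LPoset A) (l : p.carrier → B) : LPoset B where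
  carrier := p.carrier
  ord := inferInstance
  fin := inferInstance
  label := l

/-- Being series-parallel depends on the order alone. This gives passage to and from the alphabet
with a gap, and allows a node to be turned into a gap. -/
theorem Pom.IsSP.relabel {p : LPoset A} (hp : (Pom.mk p).IsSP) :
    ∀ l : p.carrier → B, (Pom.mk (p.relabel l)).IsSP := by
  refine Pom.IsSP.lposet_induction
    (motive := fun p => ∀ l : p.carrier → B, (Pom.mk (p.relabel l)).IsSP) ?_ ?_ ?_ ?_ ?_ hp
  · rintro p q ⟨h, -⟩ ih l
    rw [← Pom.mk_eq (p := p.relabel (fun x => l (h x))) (q := q.relabel l) ⟨h, fun _ => rfl⟩]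
    exact ih _
  · intro l
    rw [Pom.mk_eq (p := (LPoset.one A).relabel l) (q := LPoset.one B) ⟨OrderIso.refl _, fun x => Empty.elim x⟩]
    exact .one
  · intro a l
    rw [Pom.mk_eq (p := (LPoset.letter a).relabel l) (q := LPoset.letter (l default))
      ⟨OrderIso.refl _, fun _ => rfl⟩]
    exact .letter _
  · intro p q _ _ ihp ihq l
    rw [Pom.mk_eq (p := (p.par q).relabel l)
      (q := (p.relabel fun x => l (parInl x)).par (q.relabel fun x => l (parInr x)))
      ⟨OrderIso.refl _, by rintro (x | x) <;> rfl⟩]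
    exact .par (ihp _) (ihq _)
  · intro p q _ _ ihp ihq l
    rw [Pom.mk_eq (p := (p.seq q).relabel l)
      (q := (p.relabel fun x => l (seqInl x)).seq (q.relabel fun x => l (seqInr x)))
      ⟨OrderIso.refl _, by rintro (x | x) <;> rfl⟩]
    exact .seq (ihp _) (ihq _)

/-- The poset `p`, seen as a gap-free poset over the alphabet with the gap symbol. -/
def LPoset.gapFree (p : LPoset A) : LPoset (Option A) := p.relabel fun x => some (p.label x)

/-- The restriction of a labelled poset to a set of nodes. -/
def LPoset.restrict (p : LPoset A) (S : Set p.carrier) : LPoset A where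
  carrier := S
  ord := inferInstance
  fin := inferInstance
  label := fun x => p.label x

theorem LPoset.restrict_iso {p q : LPoset A} (h : p.carrier ≃o q.carrier)
    (hl : ∀ s, q.label (h s) = p.label s) (S : Set q.carrier) :
    (p.restrict {x | h x ∈ S}).Iso (q.restrict S) := by
  refine Iso.of_surjective (fun x => ⟨h x.1, x.2⟩) ?_ ?_ ?_
  · rintro ⟨y, hy⟩
    exact ⟨⟨h.symm y, by simpa using hy⟩, Subtype.ext (h.apply_symm_apply y)⟩
  · intro x y
    exact h.le_iff_le
  · exact fun x => hl x.1

theorem LPoset.restrict_par (p q : LPoset A) (S : Set (p.par q).carrier) :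
    ((p.par q).restrict S).Iso
      ((p.restrict {x | parInl x ∈ S}).par (q.restrict {x | parInr x ∈ S})) := by
  refine Iso.symm (Iso.of_surjective
    (parElim (fun x => ⟨parInl x.1, x.2⟩) (fun x => ⟨parInr x.1, x.2⟩)) ?_ ?_ ?_)
  · rintro ⟨x | x, hx⟩
    · exact ⟨parInl ⟨x, hx⟩, rfl⟩
    · exact ⟨parInr ⟨x, hx⟩, rfl⟩
  · rintro (x | x) (y | y)
    · exact Iff.trans parInl_le_parInl (Iff.symm (parInl_le_parInl (p := p.restrict _) (q := q.restrict _)))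
    · exact Iff.trans parInl_le_parInr (Iff.symm (parInl_le_parInr (p := p.restrict _) (q := q.restrict _)))
    · exact Iff.trans parInr_le_parInl (Iff.symm (parInr_le_parInl (p := p.restrict _) (q := q.restrict _)))
    · exact Iff.trans parInr_le_parInr (Iff.symm (parInr_le_parInr (p := p.restrict _) (q := q.restrict _)))
  · rintro (x | x) <;> rfl

theorem LPoset.restrict_seq (p q : LPoset A) (S : Set (p.seq q).carrier) :
    ((p.seq q).restrict S).Iso
      ((p.restrict {x | seqInl x ∈ S}).seq (q.restrict {x | seqInr x ∈ S})) := by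
  refine Iso.symm (Iso.of_surjective
    (seqElim (fun x => ⟨seqInl x.1, x.2⟩) (fun x => ⟨seqInr x.1, x.2⟩)) ?_ ?_ ?_)
  · rintro ⟨x | x, hx⟩
    · exact ⟨seqInl ⟨x, hx⟩, rfl⟩
    · exact ⟨seqInr ⟨x, hx⟩, rfl⟩
  · rintro (x | x) (y | y)
    · exact Iff.trans seqInl_le_seqInl (Iff.symm (seqInl_le_seqInl (p := p.restrict _) (q := q.restrict _)))
    · exact Iff.trans seqInl_le_seqInr (Iff.symm (seqInl_le_seqInr (p := p.restrict _) (q := q.restrict _)))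
    · exact Iff.trans seqInr_le_seqInl (Iff.symm (seqInr_le_seqInl (p := p.restrict _) (q := q.restrict _)))
    · exact Iff.trans seqInr_le_seqInr (Iff.symm (seqInr_le_seqInr (p := p.restrict _) (q := q.restrict _)))
  · rintro (x | x) <;> rfl

theorem LPoset.restrict_eq_empty (p : LPoset A) {S : Set p.carrier} (hS : ∀ x, x ∉ S) :
    (p.restrict S).Iso (LPoset.one A) :=
  Iso.of_surjective (fun x => (hS _ x.2).elim) (fun x => isEmptyElim x)
    (fun x => (hS _ x.2).elim) (fun x => (hS _ x.2).elim)

theorem LPoset.restrict_eq_univ (p : LPoset A) {S : Set p.carrier} (hS : ∀ x, x ∈ S) :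
    (p.restrict S).Iso p :=
  Iso.of_surjective (fun x => x.1) (fun x => ⟨⟨x, hS x⟩, rfl⟩) (fun _ _ => Iff.rfl)
    (fun _ => rfl)

/-- Restriction commutes with both compositions, and a factor that loses all its nodes becomes `1`.
No convexity of `S` is needed. -/
theorem Pom.IsSP.restrict {p : LPoset A} (hp : (Pom.mk p).IsSP) :
    ∀ S : Set p.carrier, (Pom.mk (p.restrict S)).IsSP := by
  refine Pom.IsSP.lposet_induction
    (motive := fun p => ∀ S : Set p.carrier, (Pom.mk (p.restrict S)).IsSP) ?_ ?_ ?_ ?_ ?_ hp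
  · rintro p q ⟨h, hl⟩ ih S
    rw [← Pom.mk_eq (LPoset.restrict_iso h hl S)]
    exact ih _
  · intro S
    rw [Pom.mk_eq (LPoset.restrict_eq_empty _ fun x => isEmptyElim x)]
    exact .one
  · intro a S
    by_cases h : default ∈ S
    · rw [Pom.mk_eq (LPoset.restrict_eq_univ _ fun x => by rwa [Unique.eq_default x])]
      exact .letter a
    · rw [Pom.mk_eq (LPoset.restrict_eq_empty _ fun x => by rwa [Unique.eq_default x])]
      exact .one
  · intro p q _ _ ihp ihq S
    rw [Pom.mk_eq (LPoset.restrict_par p q S)]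
    exact .par (ihp _) (ihq _)
  · intro p q _ _ ihp ihq S
    rw [Pom.mk_eq (LPoset.restrict_seq p q S)]
    exact .seq (ihp _) (ihq _)

/-! ### Subsumption -/

/-- `q` is subsumed by `p`: up to a label-preserving bijection, `q` has the nodes of `p` and at
least the order of `p`. -/
def LPoset.Sub (q p : LPoset A) : Prop :=
  ∃ h : p.carrier → q.carrier, Function.Bijective h ∧ (∀ x y, x ≤ y → h x ≤ h y) ∧
    ∀ x, q.label (h x) = p.label x

theorem LPoset.Iso.sub {p q : LPoset A} (h : p.Iso q) : q.Sub p := by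
  obtain ⟨h, hl⟩ := h
  exact ⟨h, h.bijective, fun _ _ => h.le_iff_le.2, hl⟩

theorem LPoset.Sub.trans {p q r : LPoset A} (h : p.Sub q) (k : q.Sub r) : p.Sub r := by
  obtain ⟨h, hb, hm, hl⟩ := h
  obtain ⟨k, kb, km, kl⟩ := k
  exact ⟨h ∘ k, hb.comp kb, fun _ _ e => hm _ _ (km _ _ e),
    fun x => (hl _).trans (kl _)⟩

theorem LPoset.Sub.of_surjective {p q : LPoset A} (f : p.carrier → q.carrier)
    (hi : ∀ x y, f x = f y → x = y) (hf : ∀ y, ∃ x, f x = y)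
    (hle : ∀ x y, x ≤ y → f x ≤ f y) (hl : ∀ x, q.label (f x) = p.label x) : q.Sub p :=
  ⟨f, ⟨fun x y => hi x y, hf⟩, hle, hl⟩

/-- Subsumption of pomsets. -/
def Pom.Sub (V W : Pom A) : Prop :=
  ∃ v w : LPoset A, Pom.mk v = V ∧ Pom.mk w = W ∧ v.Sub w

theorem Pom.sub_mk {p q : LPoset A} : (Pom.mk q).Sub (Pom.mk p) ↔ q.Sub p := by
  refine ⟨?_, fun h => ⟨q, p, rfl, rfl, h⟩⟩
  rintro ⟨v, w, hv, hw, h⟩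
  exact (Pom.iso_of_mk_eq hv).sub.trans (h.trans (Pom.iso_of_mk_eq hw).symm.sub)

theorem Pom.Sub.refl (U : Pom A) : U.Sub U := by
  obtain ⟨u, rfl⟩ := U.exists_mk
  exact Pom.sub_mk.2 (Iso.refl u).sub

theorem Pom.Sub.par {U U' V V' : Pom A} (h : U.Sub U') (k : V.Sub V') :
    (U.par V).Sub (U'.par V') := by
  obtain ⟨u, u', rfl, rfl, f, ⟨fi, fs⟩, fm, fl⟩ := h
  obtain ⟨v, v', rfl, rfl, g, ⟨gi, gs⟩, gm, gl⟩ := k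
  refine Pom.sub_mk.2 (Sub.of_surjective
    (parElim (fun x => parInl (f x)) (fun x => parInr (g x))) ?_ ?_ ?_ ?_)
  · simpa [par_forall] using ⟨fun x y h => fi h, fun x y h => gi h⟩
  · simpa [par_forall, par_exists] using ⟨fs, gs⟩
  · simpa [par_forall] using ⟨fm, gm⟩
  · simpa [par_forall] using ⟨fl, gl⟩

theorem Pom.Sub.seq {U U' V V' : Pom A} (h : U.Sub U') (k : V.Sub V') :
    (U.seq V).Sub (U'.seq V') := by
  obtain ⟨u, u', rfl, rfl, f, ⟨fi, fs⟩, fm, fl⟩ := h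
  obtain ⟨v, v', rfl, rfl, g, ⟨gi, gs⟩, gm, gl⟩ := k
  refine Pom.sub_mk.2 (Sub.of_surjective
    (seqElim (fun x => seqInl (f x)) (fun x => seqInr (g x))) ?_ ?_ ?_ ?_)
  · simpa [seq_forall] using ⟨fun x y h => fi h, fun x y h => gi h⟩
  · simpa [seq_forall, seq_exists] using ⟨fs, gs⟩
  · simpa [seq_forall] using ⟨fm, gm⟩
  · simpa [seq_forall] using ⟨fl, gl⟩

/-- The bijection matches the four blocks; the only order added is `U` below `X` and `V` below `W`.
-/
theorem Pom.sub_exchange (U V W X : Pom A) :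
    ((U.par V).seq (W.par X)).Sub ((U.seq W).par (V.seq X)) := by
  obtain ⟨u, rfl⟩ := U.exists_mk
  obtain ⟨v, rfl⟩ := V.exists_mk
  obtain ⟨w, rfl⟩ := W.exists_mk
  obtain ⟨x, rfl⟩ := X.exists_mk
  refine Pom.sub_mk.2 (Sub.of_surjective
    (parElim (seqElim (fun a => seqInl (parInl a)) (fun a => seqInr (parInl a)))
      (seqElim (fun a => seqInl (parInr a)) (fun a => seqInr (parInr a)))) ?_ ?_ ?_ ?_)
  all_goals simp [seq_forall, par_forall, seq_exists, par_exists]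

/-! ### Series-parallel contexts as functions on pomsets -/

/-- The functions `U ↦ C[U]` for series-parallel contexts `C`, described inductively. -/
inductive IsCtx {A : Type u} : (Pom A → Pom A) → Prop
  | id : IsCtx fun U => U
  | seqL {F : Pom A → Pom A} {V : Pom A} : IsCtx F → V.IsSP → IsCtx fun U => (F U).seq V
  | seqR {F : Pom A → Pom A} {V : Pom A} : IsCtx F → V.IsSP → IsCtx fun U => V.seq (F U)
  | parL {F : Pom A → Pom A} {V : Pom A} : IsCtx F → V.IsSP → IsCtx fun U => (F U).par V

theorem IsCtx.parR {F : Pom A → Pom A} {V : Pom A} (hF : IsCtx F) (hV : V.IsSP) :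
    IsCtx fun U => V.par (F U) := by
  simpa only [Pom.par_comm V] using hF.parL hV

theorem IsCtx.comp {F G : Pom A → Pom A} (hF : IsCtx F) (hG : IsCtx G) :
    IsCtx fun U => F (G U) := by
  induction hF with
  | id => exact hG
  | seqL _ hV ih => exact ih.seqL hV
  | seqR _ hV ih => exact ih.seqR hV
  | parL _ hV ih => exact ih.parL hV

theorem IsCtx.isSP {F : Pom A → Pom A} (hF : IsCtx F) {U : Pom A} (hU : U.IsSP) :
    (F U).IsSP := by
  induction hF with
  | id => exact hU
  | seqL _ hV ih => exact ih.seq hV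
  | seqR _ hV ih => exact hV.seq ih
  | parL _ hV ih => exact ih.par hV

theorem IsCtx.sub {F : Pom A → Pom A} (hF : IsCtx F) {U V : Pom A} (h : U.Sub V) :
    (F U).Sub (F V) := by
  induction hF with
  | id => exact h
  | seqL _ _ ih => exact ih.seq (.refl _)
  | seqR _ _ ih => exact Pom.Sub.seq (.refl _) ih
  | parL _ _ ih => exact ih.par (.refl _)

theorem Pom.IsSP.gapFree {v : LPoset A} (hv : (Pom.mk v).IsSP) : (Pom.mk v.gapFree).IsSP :=
  hv.relabel _

theorem LPoset.exists_eq_gapFree {d : LPoset (Option A)} (hd : ∀ x, d.label x ≠ none) :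
    ∃ v : LPoset A, d.Iso v.gapFree :=
  ⟨d.relabel fun x => (d.label x).get (Option.isSome_iff_ne_none.2 (hd x)),
    OrderIso.refl _, fun _ => Option.some_get _⟩

section Plug

variable {c : LPoset (Option A)} {s : c.carrier}

theorem LPoset.IsGap.parInl (hs : c.IsGap s) (v : LPoset A) :
    (c.par v.gapFree).IsGap (parInl s) :=
  ⟨hs.1, by simpa [par_forall] using ⟨hs.2, fun _ => Option.some_ne_none _⟩⟩

theorem LPoset.IsGap.seqInl (hs : c.IsGap s) (v : LPoset A) :
    (c.seq v.gapFree).IsGap (seqInl s) :=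
  ⟨hs.1, by simpa [seq_forall] using ⟨hs.2, fun _ => Option.some_ne_none _⟩⟩

theorem LPoset.IsGap.seqInr (hs : c.IsGap s) (v : LPoset A) :
    (v.gapFree.seq c).IsGap (seqInr s) :=
  ⟨hs.1, by simpa [seq_forall] using ⟨fun _ => Option.some_ne_none _, hs.2⟩⟩

theorem LPoset.plug_par (hs : c.IsGap s) (v : LPoset A)
    (hs' : (c.par v.gapFree).IsGap (LPoset.parInl s)) (p : LPoset A) :
    ((c.par v.gapFree).plug _ hs' p).Iso ((c.plug s hs p).par v) := by
  refine Iso.symm (Iso.of_surjective (LPoset.parElim (fun x => match x with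
    | .outer t ht => .outer (LPoset.parInl t) (fun h => ht (parInl_inj.1 h))
    | .inner x => .inner x) (fun x => .outer (LPoset.parInr x) parInr_ne_parInl)) ?_ ?_ ?_)
  · rintro (⟨t | t, ht⟩ | x)
    · exact ⟨LPoset.parInl (.outer t fun h => ht (h ▸ rfl)), rfl⟩
    · exact ⟨LPoset.parInr t, rfl⟩
    · exact ⟨LPoset.parInl (.inner x), rfl⟩
  · rintro ((⟨t, ht⟩ | x) | x) ((⟨t', ht'⟩ | x') | x')
    all_goals first
      | exact Iff.trans parInl_le_parInl (Iff.symm (parInl_le_parInl (p := c.plug s hs p)))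
      | exact Iff.trans parInl_le_parInr (Iff.symm (parInl_le_parInr (p := c.plug s hs p)))
      | exact Iff.trans parInr_le_parInl (Iff.symm (parInr_le_parInl (p := c.plug s hs p)))
      | exact Iff.trans parInr_le_parInr (Iff.symm (parInr_le_parInr (p := c.plug s hs p)))
      | exact Iff.symm (parInl_le_parInl (p := c.plug s hs p))
  · rintro ((⟨t, ht⟩ | x) | x) <;> rfl

theorem LPoset.plug_seqInl (hs : c.IsGap s) (v : LPoset A)
    (hs' : (c.seq v.gapFree).IsGap (LPoset.seqInl s)) (p : LPoset A) :
    ((c.seq v.gapFree).plug _ hs' p).Iso ((c.plug s hs p).seq v) := by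
  refine Iso.symm (Iso.of_surjective (LPoset.seqElim (fun x => match x with
    | .outer t ht => .outer (LPoset.seqInl t) (fun h => ht (seqInl_inj.1 h))
    | .inner x => .inner x) (fun x => .outer (LPoset.seqInr x) seqInr_ne_seqInl)) ?_ ?_ ?_)
  · rintro (⟨t | t, ht⟩ | x)
    · exact ⟨LPoset.seqInl (.outer t fun h => ht (h ▸ rfl)), rfl⟩
    · exact ⟨LPoset.seqInr t, rfl⟩
    · exact ⟨LPoset.seqInl (.inner x), rfl⟩
  · rintro ((⟨t, ht⟩ | x) | x) ((⟨t', ht'⟩ | x') | x')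
    all_goals first
      | exact Iff.trans seqInl_le_seqInl (Iff.symm (seqInl_le_seqInl (p := c.plug s hs p)))
      | exact Iff.trans seqInl_le_seqInr (Iff.symm (seqInl_le_seqInr (p := c.plug s hs p)))
      | exact Iff.trans seqInr_le_seqInl (Iff.symm (seqInr_le_seqInl (p := c.plug s hs p)))
      | exact Iff.trans seqInr_le_seqInr (Iff.symm (seqInr_le_seqInr (p := c.plug s hs p)))
      | exact Iff.symm (seqInl_le_seqInl (p := c.plug s hs p))
  · rintro ((⟨t, ht⟩ | x) | x) <;> rfl

theorem LPoset.plug_seqInr (hs : c.IsGap s) (v : LPoset A)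
    (hs' : (v.gapFree.seq c).IsGap (LPoset.seqInr s)) (p : LPoset A) :
    ((v.gapFree.seq c).plug _ hs' p).Iso (v.seq (c.plug s hs p)) := by
  refine Iso.symm (Iso.of_surjective (LPoset.seqElim
    (fun x => .outer (LPoset.seqInl x) seqInl_ne_seqInr) (fun x => match x with
    | .outer t ht => .outer (LPoset.seqInr t) (fun h => ht (seqInr_inj.1 h))
    | .inner x => .inner x)) ?_ ?_ ?_)
  · rintro (⟨t | t, ht⟩ | x)
    · exact ⟨LPoset.seqInl t, rfl⟩
    · exact ⟨LPoset.seqInr (.outer t fun h => ht (h ▸ rfl)), rfl⟩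
    · exact ⟨LPoset.seqInr (.inner x), rfl⟩
  · rintro (x | (⟨t, ht⟩ | x)) (x' | (⟨t', ht'⟩ | x'))
    all_goals first
      | exact Iff.trans seqInl_le_seqInl (Iff.symm (seqInl_le_seqInl (q := c.plug s hs p)))
      | exact Iff.trans seqInl_le_seqInr (Iff.symm (seqInl_le_seqInr (q := c.plug s hs p)))
      | exact Iff.trans seqInr_le_seqInl (Iff.symm (seqInr_le_seqInl (q := c.plug s hs p)))
      | exact Iff.trans seqInr_le_seqInr (Iff.symm (seqInr_le_seqInr (q := c.plug s hs p)))
      | exact Iff.symm (seqInr_le_seqInr (q := c.plug s hs p))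
  · rintro (x | (⟨t, ht⟩ | x)) <;> rfl

end Plug

theorem LPoset.isGap_letter (s : (LPoset.letter (none : Option A)).carrier) :
    (LPoset.letter (none : Option A)).IsGap s :=
  ⟨rfl, fun _ _ => Subsingleton.elim _ _⟩

theorem LPoset.plug_letter (s : (LPoset.letter (none : Option A)).carrier) (hs) (p : LPoset A) :
    ((LPoset.letter (none : Option A)).plug s hs p).Iso p :=
  Iso.symm (Iso.of_surjective (fun x => .inner x)
    (by
      rintro (⟨t, ht⟩ | x)
      · exact (ht (Subsingleton.elim (α := Unit) _ _)).elim
      · exact ⟨x, rfl⟩)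
    (fun _ _ => Iff.rfl) (fun _ => rfl))

theorem IsCtx.exists_lposet {F : Pom A → Pom A} (hF : IsCtx F) :
    ∃ (c : LPoset (Option A)) (s : c.carrier) (hs : c.IsGap s), (Pom.mk c).IsSP ∧
      ∀ p, Pom.mk (c.plug s hs p) = F (Pom.mk p) := by
  induction hF with
  | id => exact ⟨_, default, isGap_letter _, .letter _, fun p => Pom.mk_eq (plug_letter _ _ p)⟩
  | @seqL F V _ hV ih =>
    obtain ⟨c, s, hs, hc, h⟩ := ih
    obtain ⟨v, rfl⟩ := V.exists_mk
    refine ⟨_, _, hs.seqInl v, hc.seq hV.gapFree, fun p => ?_⟩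
    rw [Pom.mk_eq (plug_seqInl hs v _ p), Pom.mk_seq, h]
  | @seqR F V _ hV ih =>
    obtain ⟨c, s, hs, hc, h⟩ := ih
    obtain ⟨v, rfl⟩ := V.exists_mk
    refine ⟨_, _, hs.seqInr v, hV.gapFree.seq hc, fun p => ?_⟩
    rw [Pom.mk_eq (plug_seqInr hs v _ p), Pom.mk_seq, h]
  | @parL F V _ hV ih =>
    obtain ⟨c, s, hs, hc, h⟩ := ih
    obtain ⟨v, rfl⟩ := V.exists_mk
    refine ⟨_, _, hs.parInl v, hc.par hV.gapFree, fun p => ?_⟩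
    rw [Pom.mk_eq (plug_par hs v _ p), Pom.mk_par, h]

theorem IsCtx.exists_plug {F : Pom A → Pom A} (hF : IsCtx F) :
    ∃ C ∈ PCsp A, ∀ U, C.plug U = F U := by
  obtain ⟨c, s, hs, hc, h⟩ := hF.exists_lposet
  refine ⟨⟨Pom.mk c, c, rfl, s, hs⟩, hc, fun U => ?_⟩
  obtain ⟨u, rfl⟩ := U.exists_mk
  rw [PC.plug_mk c s hs, h]

theorem Pom.IsSP.of_gapFree {v : LPoset A} (hv : (Pom.mk v.gapFree).IsSP) : (Pom.mk v).IsSP :=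
  hv.relabel v.label

/-- The unique gap of a composition lies in one operand. The other operand carries no gap, hence is
a poset over `A`, and becomes the fixed argument of the corresponding `IsCtx` constructor. -/
theorem LPoset.exists_isCtx {c : LPoset (Option A)} (hc : (Pom.mk c).IsSP) :
    ∀ (s : c.carrier) (hs : c.IsGap s),
      ∃ F, IsCtx F ∧ ∀ p, Pom.mk (c.plug s hs p) = F (Pom.mk p) := by
  refine Pom.IsSP.lposet_induction (motive := fun c => ∀ (s : c.carrier) (hs : c.IsGap s),
      ∃ F, IsCtx F ∧ ∀ p, Pom.mk (c.plug s hs p) = F (Pom.mk p)) ?_ ?_ ?_ ?_ ?_ hc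
  · intro c d hcd ih t ht
    obtain ⟨h, hl⟩ := hcd
    have hs : c.IsGap (h.symm t) := by
      refine ⟨by rw [← hl, h.apply_symm_apply]; exact ht.1, fun x hx => ?_⟩
      rw [← ht.2 (h x) (by rw [hl, hx]), h.symm_apply_apply]
    obtain ⟨F, hF, hp⟩ := ih _ hs
    exact ⟨F, hF, fun p => by rw [← hp, Pom.mk_eq (plug_iso hs ht ⟨h, hl⟩ (Iso.refl p))]⟩
  · exact fun s => isEmptyElim s
  · intro a s hs
    obtain rfl : a = none := hs.1
    exact ⟨_, .id, fun p => Pom.mk_eq (plug_letter _ _ p)⟩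
  · intro c d hc hd ihc ihd
    rw [par_forall]
    constructor
    · intro s hs
      obtain ⟨v, hv⟩ := exists_eq_gapFree (d := d) fun x hx => parInr_ne_parInl (hs.2 (parInr x) hx)
      have hs' : c.IsGap s := ⟨hs.1, fun t ht => parInl_inj.1 (hs.2 (parInl t) ht)⟩
      obtain ⟨F, hF, hp⟩ := ihc s hs'
      rw [Pom.mk_eq hv] at hd
      refine ⟨_, hF.parL hd.of_gapFree, fun p => ?_⟩
      rw [← hp, ← Pom.mk_par, ← Pom.mk_eq (plug_par hs' v (hs'.parInl v) p)]
      exact Pom.mk_eq (plug_iso _ _ (par_iso (Iso.refl c) hv) (Iso.refl p))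
    · intro s hs
      obtain ⟨v, hv⟩ := exists_eq_gapFree (d := c) fun x hx => parInl_ne_parInr (hs.2 (parInl x) hx)
      have hs' : d.IsGap s := ⟨hs.1, fun t ht => parInr_inj.1 (hs.2 (parInr t) ht)⟩
      obtain ⟨F, hF, hp⟩ := ihd s hs'
      rw [Pom.mk_eq hv] at hc
      refine ⟨_, hF.parL hc.of_gapFree, fun p => ?_⟩
      rw [← hp, ← Pom.mk_par, ← Pom.mk_eq (plug_par hs' v (hs'.parInl v) p)]
      refine Pom.mk_eq (plug_iso _ _ ?_ (Iso.refl p))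
      exact Pom.iso_of_mk_eq (by rw [Pom.mk_par, Pom.mk_par, Pom.par_comm, Pom.mk_eq hv])
  · intro c d hc hd ihc ihd
    rw [seq_forall]
    constructor
    · intro s hs
      obtain ⟨v, hv⟩ := exists_eq_gapFree (d := d) fun x hx => seqInr_ne_seqInl (hs.2 (seqInr x) hx)
      have hs' : c.IsGap s := ⟨hs.1, fun t ht => seqInl_inj.1 (hs.2 (seqInl t) ht)⟩
      obtain ⟨F, hF, hp⟩ := ihc s hs'
      rw [Pom.mk_eq hv] at hd
      refine ⟨_, hF.seqL hd.of_gapFree, fun p => ?_⟩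
      rw [← hp, ← Pom.mk_seq, ← Pom.mk_eq (plug_seqInl hs' v (hs'.seqInl v) p)]
      exact Pom.mk_eq (plug_iso _ _ (seq_iso (Iso.refl c) hv) (Iso.refl p))
    · intro s hs
      obtain ⟨v, hv⟩ := exists_eq_gapFree (d := c) fun x hx => seqInl_ne_seqInr (hs.2 (seqInl x) hx)
      have hs' : d.IsGap s := ⟨hs.1, fun t ht => seqInr_inj.1 (hs.2 (seqInr t) ht)⟩
      obtain ⟨F, hF, hp⟩ := ihd s hs'
      rw [Pom.mk_eq hv] at hc
      refine ⟨_, hF.seqR hc.of_gapFree, fun p => ?_⟩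
      rw [← hp, ← Pom.mk_seq, ← Pom.mk_eq (plug_seqInr hs' v (hs'.seqInr v) p)]
      exact Pom.mk_eq (plug_iso _ _ (seq_iso hv (Iso.refl d)) (Iso.refl p))

theorem PC.exists_isCtx {C : PC A} (hC : C ∈ PCsp A) : ∃ F, IsCtx F ∧ ∀ U, C.plug U = F U := by
  obtain ⟨_, c, rfl, s, hs⟩ := C
  obtain ⟨F, hF, h⟩ := LPoset.exists_isCtx hC s hs
  refine ⟨F, hF, fun U => ?_⟩
  obtain ⟨u, rfl⟩ := U.exists_mk
  rw [PC.plug_mk c s hs, h]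

/-! ### The series-parallel subsumption order is generated by the exchange law -/

theorem sem_isSP (e : Trm A) : ∀ U ∈ sem e, U.IsSP := by
  induction e with
  | zero => exact fun U hU => hU.elim
  | one => rintro _ rfl; exact .one
  | letter a => rintro _ rfl; exact .letter a
  | plus e f he hf => exact fun U hU => hU.elim (he U) (hf U)
  | seq e f he hf => rintro _ ⟨U, hU, V, hV, rfl⟩; exact (he U hU).seq (hf V hV)
  | par e f he hf => rintro _ ⟨U, hU, V, hV, rfl⟩; exact (he U hU).par (hf V hV)
  | star e he =>
    intro U hU
    obtain ⟨n, hn⟩ := Set.mem_iUnion.1 hU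
    induction n generalizing U with
    | zero => obtain rfl := hn; exact .one
    | succ n ih =>
      obtain ⟨V, hV, W, hW, rfl⟩ := hn
      exact (ih V (Set.mem_iUnion.2 ⟨n, hV⟩) hV).seq (he W hW)

/-- The exchange law is stated for terms; this allows it to be instantiated at individual pomsets.
-/
theorem Pom.IsSP.exists_sem {U : Pom A} (hU : U.IsSP) : ∃ e : Trm A, sem e = {U} := by
  induction hU with
  | one => exact ⟨.one, rfl⟩
  | letter a => exact ⟨.letter a, rfl⟩
  | par _ _ ihU ihV =>
    obtain ⟨e, he⟩ := ihU
    obtain ⟨f, hf⟩ := ihV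
    exact ⟨.par e f, by simp [sem, he, hf]⟩
  | seq _ _ ihU ihV =>
    obtain ⟨e, he⟩ := ihU
    obtain ⟨f, hf⟩ := ihV
    exact ⟨.seq e f, by simp [sem, he, hf]⟩

/-- In every series-parallel context, `L` is contained in `X` as soon as `M` is. -/
def LangLe (X L M : Set (Pom A)) : Prop :=
  ∀ F, IsCtx F → (∀ U ∈ M, F U ∈ X) → ∀ U ∈ L, F U ∈ X

/-- The language `X` is closed under the hypotheses in `H`. -/
def HypClosed (H : Set (Hyp A)) (X : Set (Pom A)) : Prop :=
  ∀ h ∈ H, LangLe X (sem h.lhs) (sem h.rhs)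

/-! ### Closures as least hypothesis-closed languages, and monotonicity of `LangLe` -/

theorem subset_closure (H : Set (Hyp A)) (L : Set (Pom A)) : L ⊆ closure H L :=
  fun _ h => InClosure.base h

theorem hypClosed_closure (H : Set (Hyp A)) (L : Set (Pom A)) : HypClosed H (closure H L) := by
  intro h hh F hF hM U hU
  obtain ⟨C, hC, hCF⟩ := hF.exists_plug
  rw [← hCF]
  exact InClosure.step hh hC (fun V hV => (hCF V).symm ▸ hM V hV) hU

theorem closure_subset {H : Set (Hyp A)} {L X : Set (Pom A)} (hX : HypClosed H X) (hL : L ⊆ X) :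
    closure H L ⊆ X := by
  intro U hU
  induction hU with
  | base h => exact hL h
  | step hh hC _ hV ih =>
    obtain ⟨F, hF, hCF⟩ := PC.exists_isCtx hC
    rw [hCF]
    exact hX _ hh F hF (fun U hU => hCF U ▸ ih U hU) _ hV

/-- Serves as the upper bound in `closure_subset`, so that closing a series-parallel language stays
series-parallel. -/
theorem hypClosed_SP (H : Set (Hyp A)) : HypClosed H (SP A) :=
  fun h _ _ hF _ U hU => hF.isSP (sem_isSP h.lhs U hU)

section LangLe

variable {X L L' M M' N : Set (Pom A)}

theorem LangLe.of_subset (h : L ⊆ M) : LangLe X L M := fun _ _ hM U hU => hM U (h hU)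

theorem LangLe.trans (h : LangLe X L M) (k : LangLe X M N) : LangLe X L N :=
  fun F hF hN => h F hF (k F hF hN)

theorem LangLe.union (h : LangLe X L N) (k : LangLe X M N) : LangLe X (L ∪ M) N :=
  fun F hF hN U hU => hU.elim (h F hF hN U) (k F hF hN U)

/-- The factors are exchanged one at a time: the right one inside `F (U.seq _)` with `U` in `L`,
then the left one inside `F (_.seq W)` with `W` in `M'`. Hence exactly `L` and `M'` must consist of
series-parallel pomsets. -/
theorem LangLe.seq (h : LangLe X L L') (k : LangLe X M M') (hL : ∀ U ∈ L, U.IsSP)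
    (hM' : ∀ U ∈ M', U.IsSP) :
    LangLe X (Set.image2 Pom.seq L M) (Set.image2 Pom.seq L' M') := by
  rintro F hF hN _ ⟨U, hU, V, hV, rfl⟩
  refine k _ (hF.comp (IsCtx.id.seqR (hL U hU))) (fun W hW => ?_) V hV
  exact h _ (hF.comp (IsCtx.id.seqL (hM' W hW))) (fun Z hZ => hN _ ⟨Z, hZ, W, hW, rfl⟩) U hU

theorem LangLe.par (h : LangLe X L L') (k : LangLe X M M') (hL : ∀ U ∈ L, U.IsSP)
    (hM' : ∀ U ∈ M', U.IsSP) :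
    LangLe X (Set.image2 Pom.par L M) (Set.image2 Pom.par L' M') := by
  rintro F hF hN _ ⟨U, hU, V, hV, rfl⟩
  refine k _ (hF.comp (IsCtx.id.parR (hL U hU))) (fun W hW => ?_) V hV
  exact h _ (hF.comp (IsCtx.id.parL (hM' W hW))) (fun Z hZ => hN _ ⟨Z, hZ, W, hW, rfl⟩) U hU

end LangLe

theorem HypClosed.exchange {X : Set (Pom A)} (hX : HypClosed (exch A) X) {U V W Z : Pom A}
    (hU : U.IsSP) (hV : V.IsSP) (hW : W.IsSP) (hZ : Z.IsSP) :
    LangLe X {(U.par V).seq (W.par Z)} {(U.seq W).par (V.seq Z)} := by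
  obtain ⟨e, he⟩ := hU.exists_sem
  obtain ⟨f, hf⟩ := hV.exists_sem
  obtain ⟨g, hg⟩ := hW.exists_sem
  obtain ⟨k, hk⟩ := hZ.exists_sem
  simpa [sem, he, hf, hg, hk] using hX _ ⟨e, f, g, k, rfl⟩

theorem LangLe.singleton_seq {X : Set (Pom A)} {U U' V V' : Pom A} (h : LangLe X {U} {U'})
    (k : LangLe X {V} {V'}) (hU : U.IsSP) (hV' : V'.IsSP) :
    LangLe X {U.seq V} {U'.seq V'} := by
  simpa using h.seq k (by simpa using hU) (by simpa using hV')

theorem LangLe.singleton_par {X : Set (Pom A)} {U U' V V' : Pom A} (h : LangLe X {U} {U'})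
    (k : LangLe X {V} {V'}) (hU : U.IsSP) (hV' : V'.IsSP) :
    LangLe X {U.par V} {U'.par V'} := by
  simpa using h.par k (by simpa using hU) (by simpa using hV')

theorem LangLe.of_eq {X L M : Set (Pom A)} (h : L = M) : LangLe X L M := .of_subset h.subset

/-- A series-parallel poset subsumes the sequential composition of a lower set and its
complement. -/
theorem HypClosed.langLe_restrict {X : Set (Pom A)} (hX : HypClosed (exch A) X) {p : LPoset A}
    (hp : (Pom.mk p).IsSP) : ∀ S : Set p.carrier, (∀ x y, x ≤ y → y ∈ S → x ∈ S) →
      LangLe X {(Pom.mk (p.restrict S)).seq (Pom.mk (p.restrict Sᶜ))} {Pom.mk p} := by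
  refine Pom.IsSP.lposet_induction (motive := fun p => ∀ S : Set p.carrier,
    (∀ x y, x ≤ y → y ∈ S → x ∈ S) →
      LangLe X {(Pom.mk (p.restrict S)).seq (Pom.mk (p.restrict Sᶜ))} {Pom.mk p})
    ?_ ?_ ?_ ?_ ?_ hp
  · rintro p q ⟨h, hl⟩ ih S hS
    rw [← Pom.mk_eq (restrict_iso h hl S), ← Pom.mk_eq (restrict_iso h hl Sᶜ),
      ← Pom.mk_eq (p := p) ⟨h, hl⟩]
    exact ih {x | h x ∈ S} fun x y hxy => hS _ _ (h.le_iff_le.2 hxy)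
  · intro S _
    rw [Pom.mk_eq (restrict_eq_empty _ fun x => isEmptyElim x),
      Pom.mk_eq (restrict_eq_empty _ fun x => isEmptyElim x)]
    exact .of_eq (congrArg _ (Pom.seq_one Pom.one))
  · intro a S _
    by_cases h : default ∈ S
    · rw [Pom.mk_eq (restrict_eq_univ _ fun x => by rwa [Unique.eq_default x]),
        Pom.mk_eq (restrict_eq_empty (S := Sᶜ) _
          fun x => by rw [Unique.eq_default x]; exact fun k => k h)]
      exact .of_eq (congrArg _ (Pom.seq_one _))
    · rw [Pom.mk_eq (restrict_eq_empty _ fun x => by rwa [Unique.eq_default x]),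
        Pom.mk_eq (restrict_eq_univ (S := Sᶜ) _ fun x => by rwa [Unique.eq_default x])]
      exact .of_eq (congrArg _ (Pom.one_seq _))
  · intro p q hp hq ihp ihq S hS
    rw [Pom.mk_eq (restrict_par p q S), Pom.mk_eq (restrict_par p q Sᶜ)]
    -- The cut divides both operands; one exchange regroups the four pieces by operand, after which
    -- each operand is cut separately.
    refine (hX.exchange (hp.restrict _) (hq.restrict _) (hp.restrict _) (hq.restrict _)).trans ?_
    refine LangLe.singleton_par (ihp _ ?_) (ihq _ ?_) ((hp.restrict _).seq (hp.restrict _)) hq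
    · exact fun x y h => hS _ _ (parInl_le_parInl.2 h)
    · exact fun x y h => hS _ _ (parInr_le_parInr.2 h)
  · intro p q hp hq ihp ihq S hS
    rw [Pom.mk_eq (restrict_seq p q S), Pom.mk_eq (restrict_seq p q Sᶜ)]
    -- A lower set that meets the right operand contains the whole left one, so the cut falls inside
    -- `q`; otherwise it falls inside `p`.
    by_cases h : ∃ y, seqInr y ∈ S
    · obtain ⟨y, hy⟩ := h
      have hall : ∀ x, seqInl x ∈ S := fun x => hS _ _ (seqInl_le_seqInr.2 trivial) hy
      rw [Pom.mk_seq, Pom.mk_seq, Pom.mk_eq (restrict_eq_univ p (S := {x | seqInl x ∈ S}) hall),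
        Pom.mk_eq (restrict_eq_empty p (S := {x | seqInl x ∈ Sᶜ}) fun x hx => hx (hall x)),
        show Pom.mk (LPoset.one A) = Pom.one from rfl, Pom.one_seq, ← Pom.seq_assoc]
      exact LangLe.singleton_seq (.of_eq rfl)
        (ihq _ fun x y h => hS _ _ (seqInr_le_seqInr.2 h)) hp hq
    · push Not at h
      rw [Pom.mk_seq, Pom.mk_seq, Pom.mk_eq (restrict_eq_empty q (S := {x | seqInr x ∈ S}) h),
        Pom.mk_eq (restrict_eq_univ q (S := {x | seqInr x ∈ Sᶜ}) h),
        show Pom.mk (LPoset.one A) = Pom.one from rfl, Pom.seq_one, Pom.seq_assoc]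
      exact LangLe.singleton_seq (ihp _ fun x y h => hS _ _ (seqInl_le_seqInl.2 h)) (.of_eq rfl)
        ((hp.restrict _).seq (hp.restrict _)) hq

/-- The witness is `f` followed by the inverse of the embedding `i`. It splits the larger pomset `w`
along the operands of a composition `q`. -/
theorem LPoset.Sub.restrict {p q w : LPoset A} (f : w.carrier → q.carrier)
    (hf : Function.Bijective f) (hm : ∀ x y, x ≤ y → f x ≤ f y)
    (hl : ∀ x, q.label (f x) = w.label x) (i : p.carrier → q.carrier)
    (hi : ∀ x y, i x ≤ i y ↔ x ≤ y) (hil : ∀ x, q.label (i x) = p.label x) :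
    p.Sub (w.restrict {x | f x ∈ Set.range i}) := by
  have hinj : Function.Injective i := fun x y h =>
    le_antisymm ((hi x y).1 h.le) ((hi y x).1 h.ge)
  choose g hg using fun x : {x | f x ∈ Set.range i} => x.2
  refine Sub.of_surjective g ?_ ?_ ?_ ?_
  · intro x y h
    exact Subtype.ext (hf.1 ((hg x).symm.trans ((congrArg i h).trans (hg y))))
  · intro y
    obtain ⟨x, hx⟩ := hf.2 (i y)
    exact ⟨⟨x, y, hx.symm⟩, hinj ((hg _).trans hx)⟩
  · intro x y h
    rw [← hi]
    exact (hg x).trans_le ((hm _ _ h).trans_eq (hg y).symm)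
  · intro x
    rw [← hil]
    exact (congrArg q.label (hg x)).trans (hl _)

/-- Subsumption between series-parallel pomsets is derivable from the exchange law. -/
theorem HypClosed.langLe_of_sub {X : Set (Pom A)} (hX : HypClosed (exch A) X) {v : LPoset A}
    (hv : (Pom.mk v).IsSP) : ∀ w : LPoset A, (Pom.mk w).IsSP → v.Sub w →
      LangLe X {Pom.mk v} {Pom.mk w} := by
  refine Pom.IsSP.lposet_induction (motive := fun v => ∀ w : LPoset A, (Pom.mk w).IsSP → v.Sub w →
      LangLe X {Pom.mk v} {Pom.mk w}) ?_ ?_ ?_ ?_ ?_ hv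
  · intro p q h ih w hw hs
    rw [← Pom.mk_eq h]
    exact ih w hw (h.symm.sub.trans hs)
  · rintro w hw ⟨f, -, -, -⟩
    rw [Pom.mk_eq (p := w) (q := LPoset.one A)]
    · exact .of_eq rfl
    · exact Iso.of_surjective f (fun x => isEmptyElim x) (fun x => isEmptyElim (f x))
        (fun x => isEmptyElim (f x))
  · rintro a w hw ⟨f, ⟨fi, fs⟩, fm, fl⟩
    rw [Pom.mk_eq (p := w) (q := LPoset.letter a)]
    · exact .of_eq rfl
    · refine Iso.of_surjective f fs (fun x y => ?_) fl
      obtain rfl : x = y := fi (Subsingleton.elim _ _)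
      exact iff_of_true le_rfl le_rfl
  · rintro p q hp hq ihp ihq w hw ⟨f, hf, fm, fl⟩
    have hP := ihp _ (hw.restrict _)
      (Sub.restrict f hf fm fl parInl (fun _ _ => parInl_le_parInl) fun _ => rfl)
    have hQ := ihq _ (hw.restrict _)
      (Sub.restrict f hf fm fl parInr (fun _ _ => parInr_le_parInr) fun _ => rfl)
    refine (LangLe.singleton_par hP hQ hp (hw.restrict _)).trans (.of_eq (congrArg _ ?_))
    -- Since `w` has no more order than the parallel composition, its two parts are unrelated, so
    -- `w` is itself their parallel composition.
    refine Pom.mk_eq (Iso.of_surjective (parElim Subtype.val Subtype.val) ?_ ?_ ?_)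
    · intro y
      rcases h : f y with x | x
      · exact ⟨parInl ⟨y, x, h.symm⟩, rfl⟩
      · exact ⟨parInr ⟨y, x, h.symm⟩, rfl⟩
    · rintro (⟨x, a, hx⟩ | ⟨x, a, hx⟩) (⟨y, b, hy⟩ | ⟨y, b, hy⟩)
      · exact Iff.symm parInl_le_parInl
      · refine iff_of_false (fun h => ?_) (parInl_le_parInr.1 ·)
        exact parInl_le_parInr.1 (hx ▸ hy ▸ fm x y h)
      · refine iff_of_false (fun h => ?_) (parInr_le_parInl.1 ·)
        exact parInr_le_parInl.1 (hx ▸ hy ▸ fm x y h)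
      · exact Iff.symm parInr_le_parInr
    · rintro (x | x) <;> rfl
  · rintro p q hp hq ihp ihq w hw ⟨f, hf, fm, fl⟩
    have hP := ihp _ (hw.restrict _)
      (Sub.restrict f hf fm fl seqInl (fun _ _ => seqInl_le_seqInl) fun _ => rfl)
    have hQ := ihq _ (hw.restrict _)
      (Sub.restrict f hf fm fl seqInr (fun _ _ => seqInr_le_seqInr) fun _ => rfl)
    refine (LangLe.singleton_seq hP hQ hp (hw.restrict _)).trans ?_
    have hc : {x | f x ∈ Set.range seqInr} = {x | f x ∈ Set.range (seqInl : p.carrier → _)}ᶜ := by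
      ext x
      show (∃ y, seqInr y = f x) ↔ ¬ ∃ y, seqInl y = f x
      constructor
      · rintro ⟨y, hy⟩ ⟨z, hz⟩
        exact seqInr_ne_seqInl (hy.trans hz.symm)
      · intro h
        rcases hx : f x with y | y
        · exact (h ⟨y, hx.symm⟩).elim
        · exact ⟨y, rfl⟩
    rw [hc]
    -- The part of `w` over `p` is a lower set, because no node of the right operand is below one of
    -- the left.
    refine hX.langLe_restrict hw _ ?_
    rintro x y hxy ⟨b, hb⟩
    have h := fm x y hxy
    rcases hx : f x with a | a
    · exact ⟨a, hx.symm⟩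
    · rw [hx, ← hb] at h
      exact (seqInr_le_seqInl.1 h).elim

/-! ### Soundness of provable equivalence with respect to closures -/

section Star

variable {X L M N : Set (Pom A)}

theorem langPow_isSP (hL : ∀ U ∈ L, U.IsSP) (n : ℕ) : ∀ U ∈ langPow L n, U.IsSP := by
  induction n with
  | zero => rintro _ rfl; exact .one
  | succ n ih => rintro _ ⟨U, hU, V, hV, rfl⟩; exact (ih U hU).seq (hL V hV)

theorem image2_one_seq (L : Set (Pom A)) : Set.image2 Pom.seq {Pom.one} L = L := by
  simp [Pom.one_seq]

theorem image2_seq_one (L : Set (Pom A)) : Set.image2 Pom.seq L {Pom.one} = L := by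
  simp [Pom.seq_one]

theorem image2_seq_assoc (L M N : Set (Pom A)) :
    Set.image2 Pom.seq (Set.image2 Pom.seq L M) N =
      Set.image2 Pom.seq L (Set.image2 Pom.seq M N) :=
  Set.image2_assoc fun U V W => (Pom.seq_assoc U V W).symm

/-- Powers grow on the right by definition; unfolding on the left is what `star_left` and `seq_star`
require. -/
theorem langPow_succ' (L : Set (Pom A)) (n : ℕ) :
    langPow L (n + 1) = Set.image2 Pom.seq L (langPow L n) := by
  induction n with
  | zero => simp [langPow, Pom.one_seq, Pom.seq_one]
  | succ n ih =>
    rw [langPow, ih, image2_seq_assoc]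
    exact congrArg _ ih

theorem iUnion_langPow_left (L : Set (Pom A)) :
    {Pom.one} ∪ Set.image2 Pom.seq L (⋃ n, langPow L n) = ⋃ n, langPow L n := by
  rw [Set.image2_iUnion_right]
  simp_rw [← langPow_succ']
  exact Set.union_iUnion_nat_succ (langPow L)

theorem iUnion_langPow_right (L : Set (Pom A)) :
    {Pom.one} ∪ Set.image2 Pom.seq (⋃ n, langPow L n) L = ⋃ n, langPow L n := by
  rw [Set.image2_iUnion_left]
  exact Set.union_iUnion_nat_succ (langPow L)

theorem LangLe.iUnion {L : ℕ → Set (Pom A)} (h : ∀ n, LangLe X (L n) M) :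
    LangLe X (⋃ n, L n) M := by
  intro F hF hM U hU
  obtain ⟨n, hn⟩ := Set.mem_iUnion.1 hU
  exact h n F hF hM U hn

theorem LangLe.star (h : LangLe X L M) (hL : ∀ U ∈ L, U.IsSP) (hM : ∀ U ∈ M, U.IsSP) :
    LangLe X (⋃ n, langPow L n) (⋃ n, langPow M n) := by
  refine .iUnion fun n => LangLe.trans ?_ (.of_subset (Set.subset_iUnion _ n))
  induction n with
  | zero => exact .of_eq rfl
  | succ n ih => exact ih.seq h (langPow_isSP hL n) hM

/-- After `L` is replaced by `N`, the powers of `M` are absorbed into `N` one factor at a time,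
through `M ^ (n + 1) · N = M ^ n · (M · N)`. -/
theorem LangLe.star_seq (h : LangLe X L N) (k : LangLe X (Set.image2 Pom.seq M N) N)
    (hM : ∀ U ∈ M, U.IsSP) (hN : ∀ U ∈ N, U.IsSP) :
    LangLe X (Set.image2 Pom.seq (⋃ n, langPow M n) L) N := by
  rw [Set.image2_iUnion_left]
  refine .iUnion fun n => ?_
  refine LangLe.trans (LangLe.seq (.of_eq rfl) h (langPow_isSP hM n) hN) ?_
  induction n with
  | zero => exact .of_eq (image2_one_seq N)
  | succ n ih =>
    rw [langPow, image2_seq_assoc]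
    exact (LangLe.seq (.of_eq rfl) k (langPow_isSP hM n) hN).trans ih

theorem LangLe.seq_star (h : LangLe X L N) (k : LangLe X (Set.image2 Pom.seq N M) N)
    (hL : ∀ U ∈ L, U.IsSP) (hM : ∀ U ∈ M, U.IsSP) (hN : ∀ U ∈ N, U.IsSP) :
    LangLe X (Set.image2 Pom.seq L (⋃ n, langPow M n)) N := by
  rw [Set.image2_iUnion_right]
  refine .iUnion fun n => ?_
  refine LangLe.trans (LangLe.seq h (.of_eq rfl) hL (langPow_isSP hM n)) ?_
  induction n with
  | zero => exact .of_eq (image2_seq_one N)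
  | succ n ih =>
    rw [langPow_succ', ← image2_seq_assoc]
    refine (LangLe.seq k (.of_eq rfl) ?_ (langPow_isSP hM n)).trans ih
    rintro _ ⟨U, hU, V, hV, rfl⟩
    exact (hN U hU).seq (hM V hV)

end Star

/-- For a fixed hypothesis-closed `X`, mutual `LangLe X` is a congruence, since it quantifies over
all contexts. Most axioms are plain equalities of languages; only the hypotheses and the two
fixpoint rules use more. -/
theorem Eqv.sound {H : Set (Hyp A)} {X : Set (Pom A)} (hX : HypClosed H X) {e f : Trm A}
    (h : Eqv H e f) : LangLe X (sem e) (sem f) ∧ LangLe X (sem f) (sem e) := by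
  have key : ∀ {e f : Trm A}, sem e = sem f →
      LangLe X (sem e) (sem f) ∧ LangLe X (sem f) (sem e) :=
    fun h => ⟨.of_eq h, .of_eq h.symm⟩
  induction h with
  | hyp hh => exact ⟨(hX _ hh).union (.of_eq rfl), .of_subset Set.subset_union_right⟩
  | refl e => exact key rfl
  | symm _ ih => exact ih.symm
  | trans _ _ ih ih' => exact ⟨ih.1.trans ih'.1, ih'.2.trans ih.2⟩
  | plus_congr _ _ ih ih' =>
    exact ⟨(ih.1.trans (.of_subset Set.subset_union_left)).union
        (ih'.1.trans (.of_subset Set.subset_union_right)),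
      (ih.2.trans (.of_subset Set.subset_union_left)).union
        (ih'.2.trans (.of_subset Set.subset_union_right))⟩
  | seq_congr _ _ ih ih' =>
    exact ⟨ih.1.seq ih'.1 (sem_isSP _) (sem_isSP _), ih.2.seq ih'.2 (sem_isSP _) (sem_isSP _)⟩
  | par_congr _ _ ih ih' =>
    exact ⟨ih.1.par ih'.1 (sem_isSP _) (sem_isSP _), ih.2.par ih'.2 (sem_isSP _) (sem_isSP _)⟩
  | star_congr _ ih =>
    exact ⟨ih.1.star (sem_isSP _) (sem_isSP _), ih.2.star (sem_isSP _) (sem_isSP _)⟩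
  | plus_zero e => exact key (Set.union_empty _)
  | plus_idem e => exact key (Set.union_self _)
  | plus_comm e f => exact key (Set.union_comm _ _)
  | plus_assoc e f g => exact key (Set.union_assoc _ _ _).symm
  | seq_assoc e f g => exact key (image2_seq_assoc _ _ _).symm
  | seq_plus e f g => exact key Set.image2_union_right
  | plus_seq e f g => exact key Set.image2_union_left
  | seq_one e => exact key (image2_seq_one _)
  | one_seq e => exact key (image2_one_seq _)
  | seq_zero e => exact key Set.image2_empty_right
  | zero_seq e => exact key Set.image2_empty_left
  | par_comm e f => exact key (Set.image2_comm Pom.par_comm)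
  | par_one e => exact key (by simp [sem, Pom.par_one])
  | par_zero e => exact key Set.image2_empty_right
  | par_assoc e f g => exact key (Set.image2_assoc fun U V W => (Pom.par_assoc U V W).symm).symm
  | par_plus e f g => exact key Set.image2_union_right
  | star_left e => exact key (iUnion_langPow_left _)
  | star_right e => exact key (iUnion_langPow_right _)
  | lfp_left _ ih =>
    have h := (LangLe.of_subset Set.subset_union_left).trans ih.1
    exact ⟨LangLe.union (LangLe.star_seq ((LangLe.of_subset Set.subset_union_left).trans h)
        ((LangLe.of_subset Set.subset_union_right).trans h) (sem_isSP _) (sem_isSP _))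
        (.of_eq rfl), .of_subset Set.subset_union_right⟩
  | lfp_right _ ih =>
    have h := (LangLe.of_subset Set.subset_union_left).trans ih.1
    exact ⟨LangLe.union (LangLe.seq_star ((LangLe.of_subset Set.subset_union_left).trans h)
        ((LangLe.of_subset Set.subset_union_right).trans h) (sem_isSP _) (sem_isSP _)
        (sem_isSP _)) (.of_eq rfl), .of_subset Set.subset_union_right⟩

theorem HypClosed.of_implies {H H' : Set (Hyp A)} (hi : Implies H H') {X : Set (Pom A)}
    (hX : HypClosed H X) : HypClosed H' X :=
  fun h hh => (LangLe.of_subset Set.subset_union_left).trans (Eqv.sound hX (hi h hh)).1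

theorem closure_closure_of_implies {H H' : Set (Hyp A)} (hi : Implies H H') (L : Set (Pom A)) :
    closure H (closure H' L) = closure H L := by
  refine Set.Subset.antisymm (closure_subset (hypClosed_closure _ _) ?_)
    (closure_subset (hypClosed_closure _ _) ?_)
  · exact closure_subset ((hypClosed_closure H L).of_implies hi) (subset_closure _ _)
  · exact (subset_closure _ _).trans (subset_closure _ _)

/-! ### Transfer of strong reductions along a factorisation -/

theorem Eqv.mono {H H' : Set (Hyp A)} (hH : H ⊆ H') {e f : Trm A} (h : Eqv H e f) :
    Eqv H' e f := by
  induction h with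
  | hyp hh => exact .hyp (hH hh)
  | refl e => exact .refl e
  | symm _ ih => exact .symm ih
  | trans _ _ ih ih' => exact .trans ih ih'
  | plus_congr _ _ ih ih' => exact .plus_congr ih ih'
  | seq_congr _ _ ih ih' => exact .seq_congr ih ih'
  | par_congr _ _ ih ih' => exact .par_congr ih ih'
  | star_congr _ ih => exact .star_congr ih
  | lfp_left _ ih => exact .lfp_left ih
  | lfp_right _ ih => exact .lfp_right ih
  | plus_zero e => exact .plus_zero e
  | plus_idem e => exact .plus_idem e
  | plus_comm e f => exact .plus_comm e f
  | plus_assoc e f g => exact .plus_assoc e f g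
  | seq_assoc e f g => exact .seq_assoc e f g
  | seq_plus e f g => exact .seq_plus e f g
  | plus_seq e f g => exact .plus_seq e f g
  | seq_one e => exact .seq_one e
  | one_seq e => exact .one_seq e
  | seq_zero e => exact .seq_zero e
  | zero_seq e => exact .zero_seq e
  | par_comm e f => exact .par_comm e f
  | par_one e => exact .par_one e
  | par_zero e => exact .par_zero e
  | par_assoc e f g => exact .par_assoc e f g
  | par_plus e f g => exact .par_plus e f g
  | star_left e => exact .star_left e
  | star_right e => exact .star_right e

theorem Implies.of_subset {H H' : Set (Hyp A)} (h : H' ⊆ H) : Implies H H' :=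
  fun _ hh => .hyp (h hh)

/-- On languages, `H(e) = H₁(H₀(e)) = H₁(H'(r₀ e)) = H₁(r₀ e) = H'(r₁ (r₀ e))`; the third equality
holds because `H₁` implies `H'`. The condition `closure_eq` is then immediate. -/
theorem Factorises.stronglyReduces {H H₀ H₁ H' : Set (Hyp A)} (hf : Factorises H H₀ H₁)
    (h₀H : H₀ ⊆ H) (h₁H : H₁ ⊆ H) (h₀ : StronglyReduces H₀ H') (h₁ : StronglyReduces H₁ H') :
    StronglyReduces H H' := by
  obtain ⟨r₀, hr₀⟩ := h₀
  obtain ⟨r₁, hr₁⟩ := h₁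
  have key : ∀ e, closure H (sem e) = closure H' (sem (r₁ (r₀ e))) := fun e => by
    rw [hf.2.2 _ (sem_isSP e), hr₀.closure_sem, closure_closure_of_implies hr₁.implies,
      hr₁.closure_sem]
  refine ⟨fun e => r₁ (r₀ e), ⟨⟨?_, ?_, ?_⟩, key⟩⟩
  · exact fun h hh => (hr₀.implies h hh).mono h₀H
  · exact fun e => ((hr₀.eqv e).mono h₀H).trans ((hr₁.eqv (r₀ e)).mono h₁H)
  · intro e f h
    rw [← key, ← key, h]

/-! ### Lifting subsumption to contexts -/

/-- A new node can be placed above `D` and below `U` by descending through the composition until one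
of the constraints disappears or the cut between two sequential operands fits. This supplies the gap
where a context has been filled with `1` and no node marks the place. -/
theorem Pom.IsSP.exists_insert {q : LPoset A} (hq : (Pom.mk q).IsSP) :
    ∀ D U : Set q.carrier, (∀ d ∈ D, ∀ u ∈ U, d < u) →
      ∃ (c : LPoset (Option A)) (s : c.carrier) (φ : q.carrier → c.carrier),
        (Pom.mk c).IsSP ∧ c.label s = none ∧ (∀ x y, φ x ≤ φ y ↔ x ≤ y) ∧
        (∀ x, c.label (φ x) = some (q.label x)) ∧ (∀ t, t = s ∨ ∃ x, φ x = t) ∧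
        (∀ d ∈ D, φ d ≤ s) ∧ ∀ u ∈ U, s ≤ φ u := by
  -- With nothing required below it, the gap goes below all of `q`; dually for `top`.
  have bot : ∀ {q : LPoset A}, (Pom.mk q).IsSP → ∀ D U : Set q.carrier, D = ∅ →
      ∃ (c : LPoset (Option A)) (s : c.carrier) (φ : q.carrier → c.carrier),
        (Pom.mk c).IsSP ∧ c.label s = none ∧ (∀ x y, φ x ≤ φ y ↔ x ≤ y) ∧
        (∀ x, c.label (φ x) = some (q.label x)) ∧ (∀ t, t = s ∨ ∃ x, φ x = t) ∧
        (∀ d ∈ D, φ d ≤ s) ∧ ∀ u ∈ U, s ≤ φ u := by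
    rintro q hq _ U rfl
    refine ⟨(LPoset.letter none).seq q.gapFree, seqInl default,
      seqInr (p := LPoset.letter none) (q := q.gapFree),
      (Pom.IsSP.letter none).seq hq.gapFree, rfl, fun _ _ => seqInr_le_seqInr, fun _ => rfl, ?_,
      fun _ h => h.elim, fun _ _ => seqInl_le_seqInr.2 trivial⟩
    exact seq_forall.2 ⟨fun x => .inl (by rw [Unique.eq_default x]), fun x => .inr ⟨x, rfl⟩⟩
  have top : ∀ {q : LPoset A}, (Pom.mk q).IsSP → ∀ D U : Set q.carrier, U = ∅ →
      ∃ (c : LPoset (Option A)) (s : c.carrier) (φ : q.carrier → c.carrier),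
        (Pom.mk c).IsSP ∧ c.label s = none ∧ (∀ x y, φ x ≤ φ y ↔ x ≤ y) ∧
        (∀ x, c.label (φ x) = some (q.label x)) ∧ (∀ t, t = s ∨ ∃ x, φ x = t) ∧
        (∀ d ∈ D, φ d ≤ s) ∧ ∀ u ∈ U, s ≤ φ u := by
    rintro q hq D _ rfl
    refine ⟨q.gapFree.seq (LPoset.letter none), seqInr default,
      seqInl (p := q.gapFree) (q := LPoset.letter none),
      hq.gapFree.seq (Pom.IsSP.letter none), rfl, fun _ _ => seqInl_le_seqInl, fun _ => rfl, ?_,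
      fun _ _ => seqInl_le_seqInr.2 trivial, fun _ h => h.elim⟩
    exact seq_forall.2 ⟨fun x => .inr ⟨x, rfl⟩, fun x => .inl (by rw [Unique.eq_default x])⟩
  refine Pom.IsSP.lposet_induction (motive := fun q =>
    ∀ D U : Set q.carrier, (∀ d ∈ D, ∀ u ∈ U, d < u) →
      ∃ (c : LPoset (Option A)) (s : c.carrier) (φ : q.carrier → c.carrier),
        (Pom.mk c).IsSP ∧ c.label s = none ∧ (∀ x y, φ x ≤ φ y ↔ x ≤ y) ∧
        (∀ x, c.label (φ x) = some (q.label x)) ∧ (∀ t, t = s ∨ ∃ x, φ x = t) ∧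
        (∀ d ∈ D, φ d ≤ s) ∧ ∀ u ∈ U, s ≤ φ u) ?_ ?_ ?_ ?_ ?_ hq
  · rintro p q ⟨h, hl⟩ ih D U hDU
    obtain ⟨c, s, φ, hc, hs, hle, hlab, hsurj, hD, hU⟩ := ih {x | h x ∈ D} {x | h x ∈ U}
      fun d hd u hu => h.lt_iff_lt.1 (hDU _ hd _ hu)
    refine ⟨c, s, fun x => φ (h.symm x), hc, hs, fun x y => (hle _ _).trans h.symm.le_iff_le,
      fun x => ?_, fun t => ?_, fun d hd => hD _ ?_, fun u hu => hU _ ?_⟩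
    · rw [hlab, ← hl, h.apply_symm_apply]
    · rcases hsurj t with ht | ⟨x, hx⟩
      · exact .inl ht
      · exact .inr ⟨h x, (congrArg φ (h.symm_apply_apply x)).trans hx⟩
    · simpa using hd
    · simpa using hu
  · exact fun D U _ => bot .one D U (Set.eq_empty_of_isEmpty D)
  · intro a D U hDU
    by_cases hD : D = ∅
    · exact bot (.letter a) D U hD
    · refine top (.letter a) D U (Set.eq_empty_of_forall_notMem fun u hu => ?_)
      obtain ⟨d, hd⟩ := Set.nonempty_iff_ne_empty.2 hD
      exact (hDU d hd u hu).ne (Subsingleton.elim _ _)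
  · intro p q hp hq ihp ihq D U hDU
    by_cases hD : D = ∅
    · exact bot (hp.par hq) D U hD
    by_cases hU : U = ∅
    · exact top (hp.par hq) D U hU
    obtain ⟨d, hd⟩ := Set.nonempty_iff_ne_empty.2 hD
    obtain ⟨u, hu⟩ := Set.nonempty_iff_ne_empty.2 hU
    -- Comparability of every `d` with every `u` forces `D` and `U` into the same parallel operand,
    -- where the recursion continues.
    rcases d with d | d
    · have hUr : ∀ y, parInr y ∉ U := fun y hy => parInl_le_parInr.1 (hDU _ hd _ hy).le
      obtain ⟨u, rfl⟩ : ∃ x, parInl x = u := by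
        rcases u with u | u
        · exact ⟨u, rfl⟩
        · exact (hUr u hu).elim
      have hDr : ∀ y, parInr y ∉ D := fun y hy => parInr_le_parInl.1 (hDU _ hy _ hu).le
      obtain ⟨c, s, φ, hc, hs, hle, hlab, hsurj, hD, hU⟩ := ihp {x | parInl x ∈ D}
        {x | parInl x ∈ U} fun d hd u hu =>
          lt_of_le_of_ne (parInl_le_parInl.1 (hDU _ hd _ hu).le)
            fun h => (hDU _ hd _ hu).ne (congrArg _ h)
      refine ⟨c.par q.gapFree, parInl s, parElim (fun x => parInl (φ x))
        (parInr (p := c) (q := q.gapFree)),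
        hc.par hq.gapFree, hs, ?_, ?_, ?_, ?_, ?_⟩
      · refine par_forall.2 ⟨fun x => par_forall.2 ⟨fun y => ?_, fun y => ?_⟩,
          fun x => par_forall.2 ⟨fun y => ?_, fun y => ?_⟩⟩
        · exact parInl_le_parInl.trans ((hle _ _).trans parInl_le_parInl.symm)
        · exact parInl_le_parInr.trans parInl_le_parInr.symm
        · exact parInr_le_parInl.trans parInr_le_parInl.symm
        · exact parInr_le_parInr.trans (parInr_le_parInr.symm)
      · exact par_forall.2 ⟨hlab, fun _ => rfl⟩
      · refine par_forall.2 ⟨fun t => ?_, fun y => .inr ⟨parInr y, rfl⟩⟩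
        rcases hsurj t with rfl | ⟨x, rfl⟩
        · exact .inl rfl
        · exact .inr ⟨parInl x, rfl⟩
      · exact par_forall.2 ⟨fun x hx => parInl_le_parInl.2 (hD x hx),
          fun x hx => (hDr x hx).elim⟩
      · exact par_forall.2 ⟨fun x hx => parInl_le_parInl.2 (hU x hx),
          fun x hx => (hUr x hx).elim⟩
    · have hUl : ∀ y, parInl y ∉ U := fun y hy => parInr_le_parInl.1 (hDU _ hd _ hy).le
      obtain ⟨u, rfl⟩ : ∃ x, parInr x = u := by
        rcases u with u | u
        · exact (hUl u hu).elim
        · exact ⟨u, rfl⟩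
      have hDl : ∀ y, parInl y ∉ D := fun y hy => parInl_le_parInr.1 (hDU _ hy _ hu).le
      obtain ⟨c, s, φ, hc, hs, hle, hlab, hsurj, hD, hU⟩ := ihq {x | parInr x ∈ D}
        {x | parInr x ∈ U} fun d hd u hu =>
          lt_of_le_of_ne (parInr_le_parInr.1 (hDU _ hd _ hu).le)
            fun h => (hDU _ hd _ hu).ne (congrArg _ h)
      refine ⟨p.gapFree.par c, parInr s, parElim (parInl (p := p.gapFree) (q := c))
        (fun x => parInr (φ x)),
        hp.gapFree.par hc, hs, ?_, ?_, ?_, ?_, ?_⟩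
      · refine par_forall.2 ⟨fun x => par_forall.2 ⟨fun y => ?_, fun y => ?_⟩,
          fun x => par_forall.2 ⟨fun y => ?_, fun y => ?_⟩⟩
        · exact parInl_le_parInl.trans (parInl_le_parInl.symm)
        · exact parInl_le_parInr.trans parInl_le_parInr.symm
        · exact parInr_le_parInl.trans parInr_le_parInl.symm
        · exact parInr_le_parInr.trans ((hle _ _).trans parInr_le_parInr.symm)
      · exact par_forall.2 ⟨fun _ => rfl, hlab⟩
      · refine par_forall.2 ⟨fun y => .inr ⟨parInl y, rfl⟩, fun t => ?_⟩
        rcases hsurj t with rfl | ⟨x, rfl⟩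
        · exact .inl rfl
        · exact .inr ⟨parInr x, rfl⟩
      · exact par_forall.2 ⟨fun x hx => (hDl x hx).elim,
          fun x hx => parInr_le_parInr.2 (hD x hx)⟩
      · exact par_forall.2 ⟨fun x hx => (hUl x hx).elim,
          fun x hx => parInr_le_parInr.2 (hU x hx)⟩
  · intro p q hp hq ihp ihq D U hDU
    -- If `D` reaches the right operand, then `U` lies entirely there, and a gap inside it is
    -- automatically above the left part of `D`. Dually when `U` reaches the left operand. In the
    -- remaining case the gap fits between the operands.
    by_cases hDr : ∃ y, seqInr y ∈ D
    · obtain ⟨d, hd⟩ := hDr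
      have hUl : ∀ y, seqInl y ∉ U := fun y hy => seqInr_le_seqInl.1 (hDU _ hd _ hy).le
      obtain ⟨c, s, φ, hc, hs, hle, hlab, hsurj, hD, hU⟩ := ihq {x | seqInr x ∈ D}
        {x | seqInr x ∈ U} fun d hd u hu =>
          lt_of_le_of_ne (seqInr_le_seqInr.1 (hDU _ hd _ hu).le)
            fun h => (hDU _ hd _ hu).ne (congrArg _ h)
      refine ⟨p.gapFree.seq c, seqInr s, seqElim (seqInl (p := p.gapFree) (q := c))
        (fun x => seqInr (φ x)),
        hp.gapFree.seq hc, hs, ?_, ?_, ?_, ?_, ?_⟩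
      · refine seq_forall.2 ⟨fun x => seq_forall.2 ⟨fun y => ?_, fun y => ?_⟩,
          fun x => seq_forall.2 ⟨fun y => ?_, fun y => ?_⟩⟩
        · exact seqInl_le_seqInl.trans (seqInl_le_seqInl.symm)
        · exact seqInl_le_seqInr.trans seqInl_le_seqInr.symm
        · exact seqInr_le_seqInl.trans seqInr_le_seqInl.symm
        · exact seqInr_le_seqInr.trans ((hle _ _).trans seqInr_le_seqInr.symm)
      · exact seq_forall.2 ⟨fun _ => rfl, hlab⟩
      · refine seq_forall.2 ⟨fun y => .inr ⟨seqInl y, rfl⟩, fun t => ?_⟩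
        rcases hsurj t with rfl | ⟨x, rfl⟩
        · exact .inl rfl
        · exact .inr ⟨seqInr x, rfl⟩
      · exact seq_forall.2 ⟨fun x _ => seqInl_le_seqInr.2 trivial,
          fun x hx => seqInr_le_seqInr.2 (hD x hx)⟩
      · exact seq_forall.2 ⟨fun x hx => (hUl x hx).elim,
          fun x hx => seqInr_le_seqInr.2 (hU x hx)⟩
    by_cases hUl : ∃ y, seqInl y ∈ U
    · obtain ⟨c, s, φ, hc, hs, hle, hlab, hsurj, hD, hU⟩ := ihp {x | seqInl x ∈ D}
        {x | seqInl x ∈ U} fun d hd u hu =>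
          lt_of_le_of_ne (seqInl_le_seqInl.1 (hDU _ hd _ hu).le)
            fun h => (hDU _ hd _ hu).ne (congrArg _ h)
      refine ⟨c.seq q.gapFree, seqInl s, seqElim (fun x => seqInl (φ x))
        (seqInr (p := c) (q := q.gapFree)),
        hc.seq hq.gapFree, hs, ?_, ?_, ?_, ?_, ?_⟩
      · refine seq_forall.2 ⟨fun x => seq_forall.2 ⟨fun y => ?_, fun y => ?_⟩,
          fun x => seq_forall.2 ⟨fun y => ?_, fun y => ?_⟩⟩
        · exact seqInl_le_seqInl.trans ((hle _ _).trans seqInl_le_seqInl.symm)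
        · exact seqInl_le_seqInr.trans seqInl_le_seqInr.symm
        · exact seqInr_le_seqInl.trans seqInr_le_seqInl.symm
        · exact seqInr_le_seqInr.trans (seqInr_le_seqInr.symm)
      · exact seq_forall.2 ⟨hlab, fun _ => rfl⟩
      · refine seq_forall.2 ⟨fun t => ?_, fun y => .inr ⟨seqInr y, rfl⟩⟩
        rcases hsurj t with rfl | ⟨x, rfl⟩
        · exact .inl rfl
        · exact .inr ⟨seqInl x, rfl⟩
      · exact seq_forall.2 ⟨fun x hx => seqInl_le_seqInl.2 (hD x hx),
          fun x hx => (hDr ⟨x, hx⟩).elim⟩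
      · exact seq_forall.2 ⟨fun x hx => seqInl_le_seqInl.2 (hU x hx),
          fun x _ => seqInl_le_seqInr.2 trivial⟩
    · refine ⟨(p.gapFree.seq (LPoset.letter none)).seq q.gapFree, seqInl (seqInr default),
        seqElim
          (fun x => seqInl (seqInl (p := p.gapFree) x))
          (seqInr (p := p.gapFree.seq (LPoset.letter none)) (q := q.gapFree)),
        (hp.gapFree.seq (Pom.IsSP.letter none)).seq hq.gapFree, rfl, ?_, ?_, ?_, ?_, ?_⟩
      · refine seq_forall.2 ⟨fun x => seq_forall.2 ⟨fun y => ?_, fun y => ?_⟩,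
          fun x => seq_forall.2 ⟨fun y => ?_, fun y => ?_⟩⟩
        · exact seqInl_le_seqInl.trans (seqInl_le_seqInl.trans seqInl_le_seqInl.symm)
        · exact seqInl_le_seqInr.trans seqInl_le_seqInr.symm
        · exact seqInr_le_seqInl.trans seqInr_le_seqInl.symm
        · exact seqInr_le_seqInr.trans seqInr_le_seqInr.symm
      · exact seq_forall.2 ⟨fun _ => rfl, fun _ => rfl⟩
      · refine seq_forall.2 ⟨seq_forall.2 ⟨fun x => .inr ⟨seqInl x, rfl⟩,
          fun x => .inl (by rw [Unique.eq_default x])⟩, fun x => .inr ⟨seqInr x, rfl⟩⟩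
      · exact seq_forall.2 ⟨fun x _ => seqInl_le_seqInl.2 (seqInl_le_seqInr.2 trivial),
          fun x hx => (hDr ⟨x, hx⟩).elim⟩
      · exact seq_forall.2 ⟨fun x hx => (hUl ⟨x, hx⟩).elim,
          fun x _ => seqInl_le_seqInr.2 trivial⟩

theorem LPoset.Sub.plug {c c' : LPoset (Option A)} {s : c.carrier} {s' : c'.carrier}
    (hs : c.IsGap s) (hs' : c'.IsGap s') (h : c'.Sub c) (p : LPoset A) :
    (c'.plug s' hs' p).Sub (c.plug s hs p) := by
  obtain ⟨f, ⟨fi, fs⟩, fm, fl⟩ := h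
  -- Labels are preserved and the gap symbol occurs once, so gap goes to gap.
  have hss : f s = s' := hs'.2 _ (by rw [fl, hs.1])
  refine Sub.of_surjective (fun x => match x with
    | .outer t ht => .outer (f t) (fun h => ht (fi (h.trans hss.symm)))
    | .inner x => .inner x) ?_ ?_ ?_ ?_
  · rintro (⟨t, ht⟩ | x) (⟨t', ht'⟩ | x') h
    · exact PlugNode.outer_congr (fi (PlugNode.outer.inj h)) _ _
    · cases h
    · cases h
    · exact congrArg _ (PlugNode.inner.inj h)
  · rintro (⟨t, ht⟩ | x)
    · obtain ⟨y, rfl⟩ := fs t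
      exact ⟨.outer y fun h => ht (h ▸ hss), rfl⟩
    · exact ⟨.inner x, rfl⟩
  · subst hss
    rintro (⟨t, ht⟩ | x) (⟨t', ht'⟩ | x') h
    · exact fm _ _ h
    · exact fm _ _ h
    · exact fm _ _ h
    · exact h
  · rintro (⟨t, ht⟩ | x)
    · change (c'.label (f t)).get _ = (c.label t).get _
      simp only [fl]
    · rfl

/-- The bijections at hand come from plugged posets and are defined only off the gap; here they are
extended by sending gap to gap. -/
theorem LPoset.Sub.of_gap {c c' : LPoset (Option A)} {s : c.carrier} {s' : c'.carrier}
    (hs : c.IsGap s) (hs' : c'.IsGap s') (f : ∀ t, t ≠ s → c'.carrier)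
    (hne : ∀ t ht, f t ht ≠ s') (hinj : ∀ t ht u hu, f t ht = f u hu → t = u)
    (hsurj : ∀ y, y ≠ s' → ∃ t ht, f t ht = y)
    (hle : ∀ t ht u hu, t ≤ u → f t ht ≤ f u hu) (hlow : ∀ t ht, t ≤ s → f t ht ≤ s')
    (hup : ∀ t ht, s ≤ t → s' ≤ f t ht) (hl : ∀ t ht, c'.label (f t ht) = c.label t) :
    c'.Sub c := by
  classical
  obtain ⟨F, hF, hF'⟩ : ∃ F : c.carrier → c'.carrier, F s = s' ∧ ∀ t ht, F t = f t ht :=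
    ⟨fun t => if ht : t = s then s' else f t ht, dif_pos rfl, fun t ht => dif_neg ht⟩
  refine Sub.of_surjective F ?_ ?_ ?_ ?_
  · intro x y h
    by_cases hx : x = s <;> by_cases hy : y = s
    · rw [hx, hy]
    · rw [hx, hF, hF' y hy] at h
      exact (hne _ _ h.symm).elim
    · rw [hy, hF, hF' x hx] at h
      exact (hne _ _ h).elim
    · rw [hF' x hx, hF' y hy] at h
      exact hinj _ _ _ _ h
  · intro y
    by_cases hy : y = s'
    · exact ⟨s, hF.trans hy.symm⟩
    · obtain ⟨t, ht, h⟩ := hsurj y hy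
      exact ⟨t, (hF' t ht).trans h⟩
  · intro x y h
    by_cases hx : x = s <;> by_cases hy : y = s
    · rw [hx, hy]
    · rw [hx, hF, hF' y hy]
      exact hup _ _ (hx ▸ h)
    · rw [hy, hF, hF' x hx]
      exact hlow _ _ (hy ▸ h)
    · rw [hF' x hx, hF' y hy]
      exact hle _ _ _ _ h
  · intro x
    by_cases hx : x = s
    · rw [hx, hF, hs.1, hs'.1]
    · rw [hF' x hx, hl]

/-- If `q` is subsumed by `c[a]`, then it is of the form `c'[a]` with `c'` subsumed by `c`. -/
theorem LPoset.exists_sub_plug_letter {c : LPoset (Option A)} {s : c.carrier} (hs : c.IsGap s)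
    (a : A) {q : LPoset A} (hq : (Pom.mk q).IsSP) (h : q.Sub (c.plug s hs (LPoset.letter a))) :
    ∃ (c' : LPoset (Option A)) (s' : c'.carrier) (hs' : c'.IsGap s'), (Pom.mk c').IsSP ∧
      c'.Sub c ∧ (c'.plug s' hs' (LPoset.letter a)).Iso q := by
  classical
  obtain ⟨f, ⟨fi, fs⟩, fm, fl⟩ := h
  let g : q.carrier := f (.inner default)
  -- The node of `q` that matches the plugged letter becomes the gap; the order is untouched.
  let c' : LPoset (Option A) := q.relabel fun t => if t = g then none else some (q.label t)
  have hs' : c'.IsGap g := by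
    refine ⟨if_pos rfl, fun t ht => ?_⟩
    by_contra h
    have : c'.label t = some (q.label t) := if_neg h
    rw [this] at ht
    cases ht
  refine ⟨c', g, hs', hq.relabel _, ?_, ?_⟩
  · have hne : ∀ t ht, f (.outer t ht) ≠ g := fun t ht h => by cases fi h
    refine Sub.of_gap hs hs' (fun t ht => f (.outer t ht)) hne ?_ ?_ ?_ ?_ ?_ ?_
    · exact fun t ht u hu h => PlugNode.outer.inj (fi h)
    · intro y hy
      obtain ⟨⟨t, ht⟩ | x, rfl⟩ := fs y
      · exact ⟨t, ht, rfl⟩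
      · exact (hy (congrArg (fun x => f (.inner x)) (Subsingleton.elim _ _))).elim
    · exact fun t ht u hu h => fm (.outer t ht) (.outer u hu) h
    · exact fun t ht h => fm (.outer t ht) (.inner default) h
    · exact fun t ht h => fm (.inner default) (.outer t ht) h
    · intro t ht
      refine (if_neg (hne t ht)).trans ((congrArg some (fl _)).trans ?_)
      exact Option.some_get _
  · refine Iso.of_surjective (fun x => match x with
      | .outer t _ => t
      | .inner _ => g) ?_ ?_ ?_
    · intro y
      by_cases hy : y = g
      · exact ⟨.inner default, hy.symm⟩
      · exact ⟨.outer y hy, rfl⟩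
    · rintro (⟨t, ht⟩ | x) (⟨t', ht'⟩ | x')
      · exact Iff.rfl
      · exact Iff.rfl
      · exact Iff.rfl
      · exact iff_of_true le_rfl (Subsingleton.elim x x').le
    · rintro (⟨t, ht⟩ | x)
      · have : c'.label t = some (q.label t) := if_neg ht
        exact Option.some_injective _ (this.symm.trans (Option.some_get _).symm)
      · exact fl _

/-- If `q` is subsumed by `c[1]`, then it is of the form `c'[1]` with `c'` subsumed by `c`. -/
theorem LPoset.exists_sub_plug_one {c : LPoset (Option A)} {s : c.carrier} (hs : c.IsGap s)
    {q : LPoset A} (hq : (Pom.mk q).IsSP) (h : q.Sub (c.plug s hs (LPoset.one A))) :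
    ∃ (c' : LPoset (Option A)) (s' : c'.carrier) (hs' : c'.IsGap s'), (Pom.mk c').IsSP ∧
      c'.Sub c ∧ (c'.plug s' hs' (LPoset.one A)).Iso q := by
  classical
  obtain ⟨f, ⟨fi, fs⟩, fm, fl⟩ := h
  -- The constraints are the images of the nodes below and above the old gap. They are ordered by
  -- transitivity through `s`, strictly because `s` itself is excluded.
  obtain ⟨c', s', φ, hc', hl', hle, hlab, hsurj, hD, hU⟩ := hq.exists_insert
    {x | ∃ t, ∃ ht : t ≠ s, t ≤ s ∧ f (.outer t ht) = x}
    {x | ∃ t, ∃ ht : t ≠ s, s ≤ t ∧ f (.outer t ht) = x} (by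
      rintro _ ⟨t, ht, hts, rfl⟩ _ ⟨t', ht', hts', rfl⟩
      refine lt_of_le_of_ne (fm (.outer t ht) (.outer t' ht') (hts.trans hts')) fun h => ht ?_
      obtain rfl : t = t' := PlugNode.outer.inj (fi h)
      exact le_antisymm hts hts')
  have hφ : ∀ x, φ x ≠ s' := fun x h => by
    have := hlab x
    rw [h, hl'] at this
    cases this
  have φi : ∀ x y, φ x = φ y → x = y := fun x y h =>
    le_antisymm ((hle x y).1 h.le) ((hle y x).1 h.ge)
  have hs' : c'.IsGap s' := by
    refine ⟨hl', fun t ht => (hsurj t).resolve_right ?_⟩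
    rintro ⟨x, rfl⟩
    rw [hlab] at ht
    cases ht
  refine ⟨c', s', hs', hc', ?_, Iso.symm ?_⟩
  · refine Sub.of_gap hs hs' (fun t ht => φ (f (.outer t ht))) (fun t ht => hφ _) ?_ ?_ ?_ ?_ ?_ ?_
    · exact fun t ht u hu h => PlugNode.outer.inj (fi (φi _ _ h))
    · intro y hy
      obtain ⟨x, rfl⟩ := (hsurj y).resolve_left hy
      obtain ⟨⟨t, ht⟩ | x, rfl⟩ := fs x
      · exact ⟨t, ht, rfl⟩
      · exact isEmptyElim x
    · exact fun t ht u hu h => (hle _ _).2 (fm (.outer t ht) (.outer u hu) h)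
    · exact fun t ht h => hD _ ⟨t, ht, h, rfl⟩
    · exact fun t ht h => hU _ ⟨t, ht, h, rfl⟩
    · intro t ht
      refine (hlab _).trans ((congrArg some (fl _)).trans ?_)
      exact Option.some_get _
  · refine Iso.of_surjective (fun x => .outer (φ x) (hφ x)) ?_ hle ?_
    · rintro (⟨t, ht⟩ | x)
      · obtain ⟨x, rfl⟩ := (hsurj t).resolve_left ht
        exact ⟨x, rfl⟩
      · exact isEmptyElim x
    · intro x
      exact Option.some_injective _ ((Option.some_get _).trans (hlab x))

/-! ### Factorisation -/

/-- The language `X` is closed under passing to subsumed series-parallel pomsets. -/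
def SubClosed (X : Set (Pom A)) : Prop :=
  ∀ V W : Pom A, V.IsSP → V.Sub W → W ∈ X → V ∈ X

/-- Derivability of subsumption from exchange needs both pomsets series-parallel; for the larger one
this comes from `L ⊆ SP A`. -/
theorem subClosed_closure_exch {L : Set (Pom A)} (hL : L ⊆ SP A) :
    SubClosed (closure (exch A) L) := by
  rintro V W hV hVW hW
  have hW' : W.IsSP := closure_subset (hypClosed_SP _) hL hW
  obtain ⟨v, rfl⟩ := V.exists_mk
  obtain ⟨w, rfl⟩ := W.exists_mk
  exact (hypClosed_closure _ L).langLe_of_sub hV w hW' (Pom.sub_mk.1 hVW) _ .id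
    (by rintro _ rfl; exact hW) _ rfl

/-- Induction on the derivation of the larger pomset. The context found for `V` does not depend on
the right-hand side, so the induction hypothesis applies to `C'[U]` below `C[U]` for all `U` at
once. -/
theorem SubClosed.closure {H : Set (Hyp A)}
    (hH : ∀ h ∈ H, h.lhs = Trm.one ∨ ∃ a : A, h.lhs = Trm.letter a) {X : Set (Pom A)}
    (hX : SubClosed X) : SubClosed (closure H X) := by
  intro V W hV hVW hW
  induction hW generalizing V with
  | base h => exact InClosure.base (hX _ _ hV hVW h)
  | @step h C W hh hC _ hW ih =>
    obtain ⟨_, c, rfl, s, hs⟩ := C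
    obtain ⟨v, rfl⟩ := V.exists_mk
    obtain ⟨w, rfl⟩ := W.exists_mk
    rw [PC.plug_mk c s hs, Pom.sub_mk] at hVW
    obtain ⟨c', s', hs', hc', hsub, hiso⟩ : ∃ (c' : LPoset (Option A)) (s' : c'.carrier)
        (hs' : c'.IsGap s'), (Pom.mk c').IsSP ∧ c'.Sub c ∧ (c'.plug s' hs' w).Iso v := by
      rcases hH h hh with he | ⟨a, he⟩ <;> rw [he] at hW
      · have hi := Pom.iso_of_mk_eq (p := w) (q := LPoset.one A) hW
        obtain ⟨c', s', hs', hc', hsub, hiso⟩ := exists_sub_plug_one hs hV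
          (hVW.trans (plug_iso hs hs (Iso.refl c) hi.symm).sub)
        exact ⟨c', s', hs', hc', hsub, (plug_iso hs' hs' (Iso.refl c') hi).trans hiso⟩
      · have hi := Pom.iso_of_mk_eq (p := w) (q := LPoset.letter a) hW
        obtain ⟨c', s', hs', hc', hsub, hiso⟩ := exists_sub_plug_letter hs a hV
          (hVW.trans (plug_iso hs hs (Iso.refl c) hi.symm).sub)
        exact ⟨c', s', hs', hc', hsub, (plug_iso hs' hs' (Iso.refl c') hi).trans hiso⟩
    rw [← Pom.mk_eq hiso, ← PC.plug_mk c' s' hs']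
    refine InClosure.step hh hc' (fun U hU => ih U hU _ ?_ ?_) hW
    · obtain ⟨F, hF, hCF⟩ := PC.exists_isCtx (C := ⟨Pom.mk c', c', rfl, s', hs'⟩) hc'
      rw [hCF]
      exact hF.isSP (sem_isSP _ U hU)
    · obtain ⟨u, rfl⟩ := U.exists_mk
      rw [PC.plug_mk c s hs, PC.plug_mk c' s' hs', Pom.sub_mk]
      exact Sub.plug hs hs' hsub u

theorem SubClosed.hypClosed_exch {X : Set (Pom A)} (hX : SubClosed X) : HypClosed (exch A) X := by
  rintro _ ⟨e, f, g, k, rfl⟩ F hF hM _ hUV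
  have hSP := hF.isSP (sem_isSP (.seq (.par e f) (.par g k)) _ hUV)
  obtain ⟨_, ⟨U, hU, V, hV, rfl⟩, _, ⟨W, hW, Z, hZ, rfl⟩, rfl⟩ := hUV
  exact hX _ _ hSP (hF.sub (Pom.sub_exchange U V W Z))
    (hM _ ⟨_, ⟨U, hU, W, hW, rfl⟩, _, ⟨V, hV, Z, hZ, rfl⟩, rfl⟩)

theorem HypClosed.anti {H H' : Set (Hyp A)} (h : H ⊆ H') {X : Set (Pom A)}
    (hX : HypClosed H' X) : HypClosed H X :=
  fun _ hh => hX _ (h hh)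

theorem factorises_exch {H : Set (Hyp A)}
    (hH : ∀ h ∈ H, h.lhs = Trm.one ∨ ∃ a : A, h.lhs = Trm.letter a) :
    Factorises (H ∪ exch A) (exch A) H := by
  refine ⟨.of_subset Set.subset_union_right, .of_subset Set.subset_union_left, fun L hL => ?_⟩
  refine Set.Subset.antisymm (closure_subset ?_ ?_)
    (closure_subset ((hypClosed_closure _ _).anti Set.subset_union_left)
      (closure_subset ((hypClosed_closure _ _).anti Set.subset_union_right) (subset_closure _ _)))
  · rintro h (hh | hh)
    · exact hypClosed_closure H _ h hh
    · exact ((subClosed_closure_exch hL).closure hH).hypClosed_exch h hh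
  · exact (subset_closure _ _).trans (subset_closure _ _)

end CKAH

theorem mainTheorem6 {A : Type u} (H : Set (CKAH.Hyp A))
    (hH : ∀ h ∈ H, h.lhs = CKAH.Trm.one ∨ ∃ a : A, h.lhs = CKAH.Trm.letter a) :
    CKAH.Factorises (H ∪ CKAH.exch A) (CKAH.exch A) H ∧
      ∀ H' : Set (CKAH.Hyp A), CKAH.StronglyReduces (CKAH.exch A) H' →
        CKAH.StronglyReduces H H' → CKAH.StronglyReduces (H ∪ CKAH.exch A) H' :=
  ⟨CKAH.factorises_exch hH, fun _ h₀ h₁ => (CKAH.factorises_exch hH).stronglyReduces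
    Set.subset_union_right Set.subset_union_left h₀ h₁⟩
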